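/- **Setting.** Let $n\ge 1$, $[n]=\{1,\dots,n\}$, and let $\mathbb P^{n-1}_{>0}=\{[x_1:\dots:x_n]\in\mathbb P^{n-1}(\mathbb R): x_k>0 \text{ for all } k\}$, with the differential form $\Omega=\sum_{k=1}^n(-1)^{n-k}\frac{dx_1}{x_1}\wedge\dots\wedge\widehat{\frac{dx_k}{x_k}}\wedge\dots\wedge\frac{dx_n}{x_n}$ (in the chart $x_n=1$ this is $\prod_{k<n}\frac{dx_k}{x_k}$). Let $(a_i)$ and $(b_j)$ be finite families of nonzero homogeneous polynomials in $\mathbb C[x_1,\dots,x_n]$ and let $\nu_i,\rho_j\in\mathbb C$ satisfy $\operatorname{Re}\nu_i,\operatorname{Re}\rho_j\ge 0$ and $\sum_i\nu_i\deg a_i=\sum_j\rho_j\deg b_j$. Write $\mathrm{NP}_p$ for the Newton polytope of a polynomial $p$ and $p^{\mathrm{tr}}(x)=\max_{\ell\in\operatorname{supp}p}x^\ell$. Define the weighted Minkowski sums $$\mathcal A=\sum_i(\operatorname{Re}\nu_i)\,\mathrm{NP}_{a_i},\qquad \mathcal B=\sum_j(\operatorname{Re}\rho_j)\,\mathrm{NP}_{b_j},$$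 and assume that $\mathcal B$ is $(n-1)$-dimensional and that $\mathcal A\subset\operatorname{relint}\mathcal B$. Let $$\mu^{\mathrm{tr}}=\frac1{I^{\mathrm{tr}}}\,\frac{\prod_i a_i^{\mathrm{tr}}(x)^{\operatorname{Re}\nu_i}}{\prod_j b_j^{\mathrm{tr}}(x)^{\operatorname{Re}\rho_j}}\,\Omega,\qquad I^{\mathrm{tr}}=\int_{\mathbb P^{n-1}_{>0}}\frac{\prod_i a_i^{\mathrm{tr}}(x)^{\operatorname{Re}\nu_i}}{\prod_j b_j^{\mathrm{tr}}(x)^{\operatorname{Re}\rho_j}}\,\Omega .$$ Assume that $\mathcal A$ and $\mathcal B$ are generalized permutahedra, i.e. polytopes whose normal fan is a coarsening of the normal fan of the permutahedron $\operatorname{conv}\{(\sigma(1),\dots,\sigma(n)):\sigma\in S_n\}$. Let $z_{\mathcal A},z_{\mathcal B}:2^{[n]}\to\mathbb R$ be the associated boolean functions: the supermodular functions with $z_{\mathcal A}(\emptyset)=z_{\mathcal B}(\emptyset)=0$ and $$\mathcal A=\Big\{v\in\mathbb R^n:\sum_{i\in[n]}v_i=z_{\mathcal A}([n]),\ \sum_{i\in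 I}v_i\ge z_{\mathcal A}(I)\text{ for all }I\subset[n]\Big\},$$ and likewise for $\mathcal B$. Let $r:2^{[n]}\to\mathbb R$ satisfy $r(\emptyset)=1$ and $r(A)=z_{\mathcal A}(A)-z_{\mathcal B}(A)$ for all nonempty $A\subsetneq[n]$, and define $J_r$ recursively by $J_r(\emptyset)=1$ and $J_r(A)=\sum_{e\in A}\frac{J_r(A\setminus e)}{r(A\setminus e)}$ for nonempty $A\subset[n]$. **Algorithm.** Set $A=[n]$ and $\kappa=1$. While $A\ne\emptyset$: pick a random $e\in A$ with probability $p_e=\frac{1}{J_r(A)}\frac{J_r(A\setminus e)}{r(A\setminus e)}$; replace $A$ by $A\setminus e$; set $x_e=\kappa$; pick $\xi\in[0,1]$ uniformly at random (all random choices being independent, given the current $A$); replace $\kappa$ by $\kappa\,\xi^{1/r(A)}$ with the new $A$. Return $x=(x_1,\dots,x_n)$. **Proposition.** One has $r(A)>0$ for all nonempty $A\subsetneq[n]$; the output of the algorithm has a well-defined probability law; almost surely all coordinates of $x$ are positive; and the point $[x_1:\dots:x_n]\in\mathbb P^{n-1}_{>0}$ is distributed according to $\mu^{\mathrm{tr}}$.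 -/

import Mathlib

open MeasureTheory
open scoped Pointwise

noncomputable section

/-! ### Polynomials, Newton polytopes and the tropical approximation -/

/-- The Newton polytope of `p`: the convex hull of the exponent vectors of the monomials of `p`. -/
def newtonPolytope {n : ℕ} (p : MvPolynomial (Fin n) ℂ) : Set (Fin n → ℝ) :=
  convexHull ℝ ((fun (l : Fin n →₀ ℕ) (k : Fin n) => (l k : ℝ)) '' (p.support : Set (Fin n →₀ ℕ)))

/-- The weighted Minkowski sum `∑ i, (Re w i) • NP (p i)`. -/
def weightedNewtonPolytope {n : ℕ} {ι : Type*} [Fintype ι]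
    (p : ι → MvPolynomial (Fin n) ℂ) (w : ι → ℂ) : Set (Fin n → ℝ) :=
  ∑ i, (w i).re • newtonPolytope (p i)

/-- The tropical approximation `p^tr(x) = max_{l ∈ supp p} x^l`
(a maximum over a finite set, nonempty when `p ≠ 0`). -/
def tropApprox {n : ℕ} (p : MvPolynomial (Fin n) ℂ) (x : Fin n → ℝ) : ℝ :=
  ⨆ l : {l : Fin n →₀ ℕ // l ∈ p.support}, ∏ k, x k ^ (l.1 k)

/-- The integrand `∏ i, a_i^tr(x)^(Re ν_i) / ∏ j, b_j^tr(x)^(Re ρ_j)`. -/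
def tropIntegrand {n : ℕ} {ι κ : Type*} [Fintype ι] [Fintype κ]
    (a : ι → MvPolynomial (Fin n) ℂ) (b : κ → MvPolynomial (Fin n) ℂ)
    (ν : ι → ℂ) (ρ : κ → ℂ) (x : Fin n → ℝ) : ℝ :=
  (∏ i, tropApprox (a i) x ^ (ν i).re) / ∏ j, tropApprox (b j) x ^ (ρ j).re

/-! ### Generalized permutahedra -/

/-- A (bounded) polytope: the convex hull of a finite nonempty set of points. -/
def IsPolytope {n : ℕ} (P : Set (Fin n → ℝ)) : Prop :=
  ∃ s : Finset (Fin n → ℝ), s.Nonempty ∧ P = convexHull ℝ (s : Set (Fin n → ℝ))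

/-- The face of `P` on which the linear functional `y` is maximal. -/
def faceOf {n : ℕ} (P : Set (Fin n → ℝ)) (y : Fin n → ℝ) : Set (Fin n → ℝ) :=
  {v | v ∈ P ∧ ∀ w ∈ P, y ⬝ᵥ w ≤ y ⬝ᵥ v}

/-- The normal cone of the face `F` of `P`: the functionals that are maximal on all of `F`. -/
def normalCone {n : ℕ} (P F : Set (Fin n → ℝ)) : Set (Fin n → ℝ) :=
  {y | ∀ v ∈ F, ∀ w ∈ P, y ⬝ᵥ w ≤ y ⬝ᵥ v}

/-- The normal fan of `P`: the set of normal cones of its nonempty faces. -/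
def normalFan {n : ℕ} (P : Set (Fin n → ℝ)) : Set (Set (Fin n → ℝ)) :=
  {C | ∃ y : Fin n → ℝ, (faceOf P y).Nonempty ∧ C = normalCone P (faceOf P y)}

/-- The fan `F` is a coarsening of the fan `G` (`G` refines `F`):
every cone of `F` is a union of cones of `G`. -/
def IsCoarsening {n : ℕ} (F G : Set (Set (Fin n → ℝ))) : Prop :=
  ∀ C ∈ F, ∃ S ⊆ G, C = ⋃₀ S

/-- The permutahedron: the convex hull of the `n!` points `(σ(1), …, σ(n))`. -/
def permutahedron (n : ℕ) : Set (Fin n → ℝ) :=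
  convexHull ℝ (Set.range fun (σ : Equiv.Perm (Fin n)) (k : Fin n) => ((σ k : ℕ) : ℝ) + 1)

/-- A generalized permutahedron: a polytope whose normal fan coarsens the one of the
permutahedron. -/
def IsGeneralizedPermutahedron {n : ℕ} (P : Set (Fin n → ℝ)) : Prop :=
  IsPolytope P ∧ IsCoarsening (normalFan P) (normalFan (permutahedron n))

/-- `z` is the boolean function associated to the generalized permutahedron `P`: the supermodular
function with `z ∅ = 0` such that
`P = {v | ∑ i, v i = z [n], and ∑ i ∈ I, v i ≥ z I for all I ⊆ [n]}`. -/
def IsBooleanFunctionOf {n : ℕ} (z : Finset (Fin n) → ℝ) (P : Set (Fin n → ℝ)) : Prop :=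
  z ∅ = 0 ∧ (∀ I J, z I + z J ≤ z (I ∩ J) + z (I ∪ J)) ∧
    P = {v | ∑ i, v i = z Finset.univ ∧ ∀ I, z I ≤ ∑ i ∈ I, v i}

/-! ### The positive part of projective space and the tropical measure

Here there are `n = m + 1` homogeneous coordinates, so that projective space has dimension `m`. -/

/-- The measurable structure on projective space: the quotient of the Borel structure on the
nonzero vectors. -/
instance instMeasurableSpaceRealProj (m : ℕ) :
    MeasurableSpace (Projectivization ℝ (Fin (m + 1) → ℝ)) :=
  MeasurableSpace.map (Projectivization.mk' ℝ) inferInstance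

/-- The positive orthant `{[x_1 : … : x_n] | x_k > 0 for all k}` of real projective space. -/
abbrev PosProj (m : ℕ) : Type :=
  {p : Projectivization ℝ (Fin (m + 1) → ℝ) //
    ∃ (x : Fin (m + 1) → ℝ) (hx : x ≠ 0), (∀ k, 0 < x k) ∧ p = Projectivization.mk ℝ x hx}

theorem ne_zero_of_all_pos {m : ℕ} {x : Fin (m + 1) → ℝ} (hx : ∀ k, 0 < x k) : x ≠ 0 :=
  fun h => (hx 0).ne' (congrFun h 0)

/-- The point `[x_1 : … : x_n]` for a vector `x` with positive coordinates. -/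
def PosProj.mk {m : ℕ} (x : Fin (m + 1) → ℝ) (hx : ∀ k, 0 < x k) : PosProj m :=
  ⟨Projectivization.mk ℝ x (ne_zero_of_all_pos hx), x, ne_zero_of_all_pos hx, hx, rfl⟩

/-- The map `x ↦ [x_1 : … : x_n]`, extended by the value `[1 : … : 1]` to vectors that do not have
positive coordinates. -/
def toPosProj {m : ℕ} (x : Fin (m + 1) → ℝ) : PosProj m :=
  open Classical in
  if hx : ∀ k, 0 < x k then PosProj.mk x hx else PosProj.mk (fun _ => 1) fun _ => one_pos

/-- The representative `(x_1, …, x_n)` with `x_n = 1` of a point of the positive orthant. -/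
def PosProj.affineRep {m : ℕ} (p : PosProj m) : Fin (m + 1) → ℝ :=
  fun k => p.1.rep k / p.1.rep (Fin.last m)

/-- The affine chart `(x_1, …, x_{n-1}) ↦ [x_1 : … : x_{n-1} : 1]`. -/
def affineChart (m : ℕ) (x : {x : Fin m → ℝ // ∀ k, 0 < x k}) : PosProj m :=
  PosProj.mk (Fin.snoc x.1 (1 : ℝ)) (by
    intro k
    refine Fin.lastCases ?_ (fun i => ?_) k
    · simp
    · simpa using x.2 i)

/-- The measure on the positive orthant of projective space given by the differential form
`Ω = ∑ k, (-1)^(n-k) dx_1/x_1 ∧ … (without dx_k/x_k) … ∧ dx_n/x_n`,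
which is `∏_{k < n} dx_k/x_k` in the affine chart `x_n = 1`. -/
def canonicalMeasure (m : ℕ) : Measure (PosProj m) :=
  Measure.map (affineChart m) (Measure.comap Subtype.val
    ((volume : Measure (Fin m → ℝ)).withDensity fun x => ENNReal.ofReal (∏ k, (x k)⁻¹)))

/-- The function on the positive orthant of projective space given by the homogeneous function
`tropIntegrand` of degree `0` (see `tropIntegrand_smul`). -/
def tropDensity {m : ℕ} {ι κ : Type*} [Fintype ι] [Fintype κ]
    (a : ι → MvPolynomial (Fin (m + 1)) ℂ) (b : κ → MvPolynomial (Fin (m + 1)) ℂ)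
    (ν : ι → ℂ) (ρ : κ → ℂ) (p : PosProj m) : ENNReal :=
  ENNReal.ofReal (tropIntegrand a b ν ρ p.affineRep)

/-- The tropical integral `I^tr`, with values in `[0, ∞]`. -/
def tropIntegral {m : ℕ} {ι κ : Type*} [Fintype ι] [Fintype κ]
    (a : ι → MvPolynomial (Fin (m + 1)) ℂ) (b : κ → MvPolynomial (Fin (m + 1)) ℂ)
    (ν : ι → ℂ) (ρ : κ → ℂ) : ENNReal :=
  ∫⁻ p, tropDensity a b ν ρ p ∂canonicalMeasure m

/-- The normalized tropical measure `μ^tr`. -/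
def tropMeasure {m : ℕ} {ι κ : Type*} [Fintype ι] [Fintype κ]
    (a : ι → MvPolynomial (Fin (m + 1)) ℂ) (b : κ → MvPolynomial (Fin (m + 1)) ℂ)
    (ν : ι → ℂ) (ρ : κ → ℂ) : Measure (PosProj m) :=
  (tropIntegral a b ν ρ)⁻¹ • (canonicalMeasure m).withDensity (tropDensity a b ν ρ)

/-! ### The sampling algorithm -/

/-- The function `J_r`, defined by `J_r(∅) = 1` and
`J_r(A) = ∑ e ∈ A, J_r(A \ e) / r(A \ e)` for nonempty `A`. -/
def gpJ {n : ℕ} (r : Finset (Fin n) → ℝ) (A : Finset (Fin n)) : ℝ :=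
  if A = ∅ then 1 else ∑ e : {e // e ∈ A}, gpJ r (A.erase e.1) / r (A.erase e.1)
termination_by A.card
decreasing_by exact Finset.card_erase_lt_of_mem e.2

/-- The probability `p_e = J_r(A \ e) / (J_r(A) r(A \ e))` of picking `e ∈ A`. -/
def gpProb {n : ℕ} (r : Finset (Fin n) → ℝ) (A : Finset (Fin n)) (e : Fin n) : ℝ :=
  1 / gpJ r A * (gpJ r (A.erase e) / r (A.erase e))

/-- The law of the vector returned by the loop of the algorithm when it is entered with the
remaining set `A`, the current value `t` of the running factor, and the vector `x` of the
coordinates assigned so far: while `A` is nonempty, pick `e ∈ A` with probability `p_e`, remove `e`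
from `A`, set `x_e = t`, pick `ξ` uniformly from `[0,1]`, and replace `t` by `t * ξ ^ (1 / r(A))`
(with the new `A`). -/
def gpLoop {n : ℕ} (r : Finset (Fin n) → ℝ) (A : Finset (Fin n)) (t : ℝ) (x : Fin n → ℝ) :
    Measure (Fin n → ℝ) :=
  if A = ∅ then Measure.dirac x
  else ∑ e : {e // e ∈ A}, ENNReal.ofReal (gpProb r A e.1) •
    ((volume : Measure ℝ).restrict (Set.Icc 0 1)).bind fun ξ =>
      gpLoop r (A.erase e.1) (t * ξ ^ (1 / r (A.erase e.1))) (Function.update x e.1 t)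
termination_by A.card
decreasing_by exact Finset.card_erase_lt_of_mem e.2

/-- The law of the vector `(x_1, …, x_n)` returned by the algorithm, which starts with `A = [n]`
and the factor `1`. (The initial vector `0` is irrelevant: each coordinate gets assigned once.) -/
def gpSampling {n : ℕ} (r : Finset (Fin n) → ℝ) : Measure (Fin n → ℝ) :=
  gpLoop r Finset.univ 1 0

/-! ### Well-definedness of the density -/

theorem tropApprox_nonneg {n : ℕ} (p : MvPolynomial (Fin n) ℂ) {x : Fin n → ℝ}
    (hx : ∀ k, 0 < x k) : 0 ≤ tropApprox p x :=
  Real.iSup_nonneg fun _ => Finset.prod_nonneg fun k _ => pow_nonneg (hx k).le _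

theorem tropApprox_smul {n d : ℕ} {p : MvPolynomial (Fin n) ℂ} (hp : p.IsHomogeneous d)
    (x : Fin n → ℝ) {c : ℝ} (hc : 0 < c) : tropApprox p (c • x) = c ^ d * tropApprox p x := by
  unfold tropApprox
  rw [Real.mul_iSup_of_nonneg (pow_nonneg hc.le d)]
  congr 1
  funext l
  have hl : ∑ k, l.1 k = d := by
    have h := hp (MvPolynomial.mem_support_iff.1 l.2)
    rw [← h, Finsupp.weight_apply, Finsupp.sum_fintype] <;> simp
  simp only [Pi.smul_apply, smul_eq_mul, mul_pow, Finset.prod_mul_distrib,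
    Finset.prod_pow_eq_pow_sum, hl]

/-- The integrand is homogeneous of degree `0`, hence a function on projective space. -/
theorem tropIntegrand_smul {n : ℕ} {ι κ : Type*} [Fintype ι] [Fintype κ]
    {a : ι → MvPolynomial (Fin n) ℂ} {b : κ → MvPolynomial (Fin n) ℂ} {ν : ι → ℂ} {ρ : κ → ℂ}
    (ha : ∀ i, (a i).IsHomogeneous (a i).totalDegree)
    (hb : ∀ j, (b j).IsHomogeneous (b j).totalDegree)
    (hdeg : ∑ i, ν i * ((a i).totalDegree : ℂ) = ∑ j, ρ j * ((b j).totalDegree : ℂ))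
    {x : Fin n → ℝ} (hx : ∀ k, 0 < x k) {c : ℝ} (hc : 0 < c) :
    tropIntegrand a b ν ρ (c • x) = tropIntegrand a b ν ρ x := by
  have key : ∀ (d : ℕ) (p : MvPolynomial (Fin n) ℂ) (s : ℝ), p.IsHomogeneous d →
      tropApprox p (c • x) ^ s = c ^ (s * d) * tropApprox p x ^ s := by
    intro d p s hp
    rw [tropApprox_smul hp x hc, Real.mul_rpow (pow_nonneg hc.le d) (tropApprox_nonneg p hx),
      ← Real.rpow_natCast, ← Real.rpow_mul hc.le, mul_comm s]
  have hre : ∑ i, (ν i).re * ((a i).totalDegree : ℝ) = ∑ j, (ρ j).re * ((b j).totalDegree : ℝ) := by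
    simpa using congrArg Complex.re hdeg
  unfold tropIntegrand
  simp only [fun i => key _ (a i) (ν i).re (ha i), fun j => key _ (b j) (ρ j).re (hb j),
    Finset.prod_mul_distrib, ← Real.rpow_sum_of_pos hc, hre]
  exact mul_div_mul_left _ _ (Real.rpow_pos_of_pos hc _).ne'

end

noncomputable section

/-! ### The Lovász extension of a set function -/

section Lovasz

variable {ι : Type*} [DecidableEq ι]

/-! Put `x = exp w`. Each product of powers of tropical approximations becomes the exponential of
the support function of its weighted Newton polytope. For the base polytope of a supermodular `z`,
the greedy algorithm computes this support function: it is `max w * z [n] - lovaszSum z [n] w`, a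
sum over threshold sets of `w` (`isGreatest_dotProduct_basePolytope`). Since `zA [n] = zB [n]`, the
integrand equals `exp (-lovaszSum r [n] w)` (`tropIntegrand_exp`).

The Lovász sum is recursive: deleting a maximizer `e` from `A` removes the term `r (A \ e)` times
the distance from `w e` to the next largest value (`lovaszSum_insert`). So, once the order of the
coordinates is fixed, successive gaps have independent exponential densities. The algorithm samples
exactly these: `log (ξ ^ (1 / q))` is minus an exponential variable of rate `q`. Its normalizing
factor `q = r (A \ e)` cancels the denominator in `p_e`, and the factors `J_r` telescope
(`gpJ_mul_lintegral_gpLoop`).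

The output thus lies, for each `e`, in the chart `w e = 0`, on the region where `e` is the
maximizer. Translation invariance moves all these regions to the chart `w n = 0`
(`lmarginal_erase_update_eq`), where they tile space up to ties. Total mass gives `I^tr = J_r [n]`.
Positivity of `r` comes from `lt_of_subset_intrinsicInterior`. -/

/-- The length of the interval of thresholds that separate the values of `w` on `T` from the larger
values of `w` on `A \ T`. -/
def setGap (A T : Finset ι) (w : ι → ℝ) : ℝ :=
  if h : T.Nonempty ∧ (A \ T).Nonempty then
    max 0 ((A \ T).inf' h.2 w - T.sup' h.1 w) else 0

/-- The sum of the values of `R` on the proper lower sets of `A` with respect to `w`,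
weighted by the corresponding gaps. -/
def lovaszSum (R : Finset ι → ℝ) (A : Finset ι) (w : ι → ℝ) : ℝ :=
  ∑ T ∈ A.powerset, R T * setGap A T w

theorem setGap_self (A : Finset ι) (w : ι → ℝ) : setGap A A w = 0 := by
  simp [setGap]

theorem setGap_nonneg (A T : Finset ι) (w : ι → ℝ) : 0 ≤ setGap A T w := by
  unfold setGap
  split_ifs
  · exact le_max_left _ _
  · exact le_rfl

theorem setGap_eq_zero {A T : Finset ι} {w : ι → ℝ} {a b : ι} (ha : a ∈ A \ T) (hb : b ∈ T)
    (h : w a ≤ w b) : setGap A T w = 0 := by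
  unfold setGap
  rw [dif_pos ⟨⟨b, hb⟩, ⟨a, ha⟩⟩]
  refine max_eq_left (sub_nonpos.2 ?_)
  exact (Finset.inf'_le w ha).trans (h.trans (Finset.le_sup' w hb))

theorem continuous_setGap (A T : Finset ι) : Continuous (setGap A T) := by
  unfold setGap
  split_ifs with h
  · refine continuous_const.max (Continuous.sub ?_ ?_)
    · exact Continuous.finset_inf'_apply h.2 fun i _ => continuous_apply i
    · exact Continuous.finset_sup'_apply h.1 fun i _ => continuous_apply i
  · exact continuous_const

theorem continuous_lovaszSum (R : Finset ι → ℝ) (A : Finset ι) : Continuous (lovaszSum R A) :=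
  continuous_finsetSum _ fun T _ => continuous_const.mul (continuous_setGap A T)

theorem lovaszSum_sub (R S : Finset ι → ℝ) (A : Finset ι) (w : ι → ℝ) :
    lovaszSum (fun T => R T - S T) A w = lovaszSum R A w - lovaszSum S A w := by
  simp only [lovaszSum, sub_mul, Finset.sum_sub_distrib]

/-- The sets `∅` and `A` have gap zero by convention, so the values of `R` there are irrelevant. -/
theorem lovaszSum_congr {R S : Finset ι → ℝ} {A : Finset ι}
    (h : ∀ T ⊆ A, T.Nonempty → T ≠ A → R T = S T) (w : ι → ℝ) :
    lovaszSum R A w = lovaszSum S A w := by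
  refine Finset.sum_congr rfl fun T hT => ?_
  rw [Finset.mem_powerset] at hT
  by_cases h1 : T.Nonempty
  · by_cases h2 : T = A
    · subst h2
      simp [setGap_self]
    · rw [h T hT h1 h2]
  · simp [setGap, h1]

theorem lovaszSum_singleton (R : Finset ι → ℝ) (e : ι) (w : ι → ℝ) : lovaszSum R {e} w = 0 := by
  refine Finset.sum_eq_zero fun T hT => ?_
  rcases Finset.subset_singleton_iff.1 (Finset.mem_powerset.1 hT) with rfl | rfl
  · simp [setGap]
  · simp [setGap_self]

theorem setGap_insert_of_subset {s T : Finset ι} {e : ι} {w : ι → ℝ} (he : e ∉ s)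
    (hmax : ∀ k ∈ s, w k ≤ w e) (hT : T ⊆ s) (hTs : T ≠ s) :
    setGap (insert e s) T w = setGap s T w := by
  have hne : (s \ T).Nonempty := by
    rw [Finset.sdiff_nonempty]
    exact fun h => hTs (hT.antisymm h)
  by_cases h1 : T.Nonempty
  · have hs : insert e s \ T = insert e (s \ T) := Finset.insert_sdiff_of_notMem _ fun h => he (hT h)
    have hne' : (insert e s \ T).Nonempty := by
      rw [hs]
      exact Finset.insert_nonempty _ _
    unfold setGap
    rw [dif_pos ⟨h1, hne'⟩, dif_pos ⟨h1, hne⟩]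
    simp only [hs]
    rw [Finset.inf'_insert hne, inf_eq_right.2]
    obtain ⟨k, hk⟩ := hne
    exact (Finset.inf'_le w hk).trans (hmax k (Finset.mem_sdiff.1 hk).1)
  · simp [setGap, h1]

theorem setGap_insert_self {s : Finset ι} {e : ι} {w : ι → ℝ} (he : e ∉ s) (hs : s.Nonempty)
    (hmax : ∀ k ∈ s, w k ≤ w e) : setGap (insert e s) s w = w e - s.sup' hs w := by
  have h : insert e s \ s = {e} := by
    rw [Finset.insert_sdiff_of_notMem _ he]
    simp
  unfold setGap
  rw [dif_pos ⟨hs, by rw [h]; simp⟩]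
  simp only [h, Finset.inf'_singleton]
  exact max_eq_right (sub_nonneg.2 (Finset.sup'_le hs w hmax))

/-- Removing a maximizer of `w`. -/
theorem lovaszSum_insert (R : Finset ι → ℝ) {s : Finset ι} {e : ι} {w : ι → ℝ} (he : e ∉ s)
    (hs : s.Nonempty) (hmax : ∀ k ∈ s, w k ≤ w e) :
    lovaszSum R (insert e s) w = R s * (w e - s.sup' hs w) + lovaszSum R s w := by
  -- A set containing the maximizer `e` is either all of `insert e s` or omits an element of value
  -- at most `w e`; its gap vanishes in both cases.
  have h2 : ∀ T ∈ s.powerset, R (insert e T) * setGap (insert e s) (insert e T) w = 0 := by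
    intro T hT
    rw [Finset.mem_powerset] at hT
    by_cases h : T = s
    · simp [h, setGap_self]
    · obtain ⟨k, hk, hkT⟩ := Finset.exists_of_ssubset (hT.ssubset_of_ne h)
      rw [setGap_eq_zero (a := k) (b := e) _ (Finset.mem_insert_self _ _) (hmax k hk), mul_zero]
      simp only [Finset.mem_sdiff, Finset.mem_insert, hk, hkT, or_true, or_false, true_and]
      rintro rfl
      exact he hk
  have h1 : ∀ T ∈ s.powerset, R T * setGap (insert e s) T w =
      (if T = s then R s * (w e - s.sup' hs w) else 0) + R T * setGap s T w := by
    intro T hT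
    rw [Finset.mem_powerset] at hT
    split_ifs with h
    · rw [h, setGap_self, setGap_insert_self he hs hmax, mul_zero, add_zero]
    · rw [setGap_insert_of_subset he hmax hT h, zero_add]
  unfold lovaszSum
  rw [Finset.sum_powerset_insert he, Finset.sum_eq_zero h2, add_zero, Finset.sum_congr rfl h1,
    Finset.sum_add_distrib]
  simp

/-- Abel summation along the increasing order of `w`, carried out by peeling off maximizers. -/
theorem sum_mul_eq_lovaszSum (v w : ι → ℝ) {A : Finset ι} (hA : A.Nonempty) :
    ∑ k ∈ A, w k * v k = A.sup' hA w * ∑ k ∈ A, v k - lovaszSum (fun T => ∑ k ∈ T, v k) A w := by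
  induction A using Finset.strongInduction with
  | H A ih =>
    obtain ⟨e, he, hmax⟩ := Finset.exists_max_image A w hA
    have hsup : A.sup' hA w = w e :=
      le_antisymm (Finset.sup'_le hA w hmax) (Finset.le_sup' w he)
    rw [hsup]
    obtain ⟨s, hes, rfl⟩ : ∃ s, e ∉ s ∧ A = insert e s :=
      ⟨A.erase e, Finset.notMem_erase _ _, (Finset.insert_erase he).symm⟩
    rcases s.eq_empty_or_nonempty with rfl | hs
    · simp [lovaszSum_singleton]
    · have hm : ∀ k ∈ s, w k ≤ w e := fun k hk => hmax k (Finset.mem_insert_of_mem hk)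
      rw [lovaszSum_insert _ hes hs hm, Finset.sum_insert hes, Finset.sum_insert hes,
        ih s (Finset.ssubset_insert hes) hs]
      ring

/-- The greedy algorithm for supermodular functions. -/
theorem exists_greedy_vertex {z : Finset ι → ℝ} (h0 : z ∅ = 0)
    (hz : ∀ I J, z I + z J ≤ z (I ∩ J) + z (I ∪ J)) (w : ι → ℝ) (A : Finset ι) :
    ∃ v : ι → ℝ, (∀ I ⊆ A, z I ≤ ∑ i ∈ I, v i) ∧
      ∀ T ⊆ A, (∀ a ∈ A \ T, ∀ b ∈ T, w b < w a) → ∑ i ∈ T, v i = z T := by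
  induction A using Finset.strongInduction with
  | H A ih =>
    rcases A.eq_empty_or_nonempty with rfl | hA
    · refine ⟨0, fun I hI => ?_, fun T hT _ => ?_⟩
      · simp [Finset.subset_empty.1 hI, h0]
      · simp [Finset.subset_empty.1 hT, h0]
    obtain ⟨e, he, hmax⟩ := Finset.exists_max_image A w hA
    obtain ⟨s, hes, rfl⟩ : ∃ s, e ∉ s ∧ A = insert e s :=
      ⟨A.erase e, Finset.notMem_erase _ _, (Finset.insert_erase he).symm⟩
    obtain ⟨v, hv1, hv2⟩ := ih s (Finset.ssubset_insert hes)
    have hsum : ∀ I : Finset ι, e ∉ I →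
        ∑ i ∈ I, Function.update v e (z (insert e s) - z s) i = ∑ i ∈ I, v i := by
      intro I hI
      exact Finset.sum_congr rfl fun i hi => Function.update_of_ne (ne_of_mem_of_not_mem hi hI) _ _
    have hs : ∑ i ∈ s, v i = z s := hv2 s le_rfl (by simp)
    have hfull : ∑ i ∈ insert e s, Function.update v e (z (insert e s) - z s) i =
        z (insert e s) := by
      rw [Finset.sum_insert hes, hsum s hes, hs, Function.update_self]
      ring
    -- Greedy choice: the new coordinate is the marginal value of `e`, which makes the constraint of
    -- `insert e s` tight.
    refine ⟨Function.update v e (z (insert e s) - z s), fun I hI => ?_, fun T hT hw => ?_⟩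
    · by_cases heI : e ∈ I
      · obtain ⟨J, heJ, rfl⟩ : ∃ J, e ∉ J ∧ I = insert e J :=
          ⟨I.erase e, Finset.notMem_erase _ _, (Finset.insert_erase heI).symm⟩
        have hJ : J ⊆ s := (Finset.insert_subset_insert_iff heJ).1 hI
        have h1 : insert e J ∩ s = J := by
          rw [Finset.insert_inter_of_notMem hes, Finset.inter_eq_left.2 hJ]
        have h2 : insert e J ∪ s = insert e s := by
          rw [Finset.insert_union, Finset.union_eq_right.2 hJ]
        -- Supermodularity says that the marginal value of `e` over `J` is at most its marginal
        -- value over the larger set `s`.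
        have h3 := hz (insert e J) s
        rw [h1, h2] at h3
        rw [Finset.sum_insert heJ, hsum J heJ, Function.update_self]
        linarith [hv1 J hJ]
      · rw [hsum I heI]
        exact hv1 I ((Finset.subset_insert_iff_of_notMem heI).1 hI)
    · by_cases heT : e ∈ T
      · have : T = insert e s := by
          refine hT.antisymm fun a ha => ?_
          by_contra haT
          exact absurd (hmax a ha) (not_le.2 (hw a (Finset.mem_sdiff.2 ⟨ha, haT⟩) e heT))
        rw [this, hfull]
      · rw [hsum T heT]
        refine hv2 T ((Finset.subset_insert_iff_of_notMem heT).1 hT) fun a ha b hb => ?_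
        exact hw a (Finset.sdiff_subset_sdiff (Finset.subset_insert e s) le_rfl ha) b hb

/-- The support function of the base polytope of a supermodular function. -/
theorem isGreatest_dotProduct_basePolytope [Fintype ι] [Nonempty ι] {z : Finset ι → ℝ}
    (h0 : z ∅ = 0) (hz : ∀ I J, z I + z J ≤ z (I ∩ J) + z (I ∪ J)) (w : ι → ℝ) :
    IsGreatest ((fun v => w ⬝ᵥ v) ''
        {v : ι → ℝ | ∑ i, v i = z Finset.univ ∧ ∀ I, z I ≤ ∑ i ∈ I, v i})
      (Finset.univ.sup' Finset.univ_nonempty w * z Finset.univ - lovaszSum z Finset.univ w) := by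
  constructor
  · obtain ⟨v, hv1, hv2⟩ := exists_greedy_vertex h0 hz w Finset.univ
    have hu : ∑ i, v i = z Finset.univ := hv2 _ le_rfl (by simp)
    refine ⟨v, ⟨hu, fun I => hv1 I (Finset.subset_univ I)⟩, ?_⟩
    have h := sum_mul_eq_lovaszSum v w Finset.univ_nonempty
    rw [hu] at h
    change ∑ k, w k * v k = _
    rw [h]
    congr 1
    refine Finset.sum_congr rfl fun T _ => ?_
    -- On strict lower sets of `w` the greedy vertex is tight; every other set has gap zero.
    by_cases hT : ∀ a ∈ Finset.univ \ T, ∀ b ∈ T, w b < w a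
    · simp only [hv2 T (Finset.subset_univ T) hT]
    · push Not at hT
      obtain ⟨a, ha, b, hb, hab⟩ := hT
      rw [setGap_eq_zero ha hb hab, mul_zero, mul_zero]
  · rintro _ ⟨v, ⟨hv1, hv2⟩, rfl⟩
    have h := sum_mul_eq_lovaszSum v w Finset.univ_nonempty
    rw [hv1] at h
    change ∑ k, w k * v k ≤ _
    rw [h]
    refine sub_le_sub_left (Finset.sum_le_sum fun T _ => ?_) _
    exact mul_le_mul_of_nonneg_right (hv2 T) (setGap_nonneg _ _ _)

end Lovasz

/-! ### Support functions of Newton polytopes -/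

theorem exists_isGreatest_newtonPolytope {n : ℕ} {p : MvPolynomial (Fin n) ℂ} (hp : p ≠ 0)
    (w : Fin n → ℝ) :
    ∃ M, IsGreatest ((fun v => w ⬝ᵥ v) '' newtonPolytope p) M ∧
      tropApprox p (fun k => Real.exp (w k)) = Real.exp M := by
  obtain ⟨l, hl, hmax⟩ := Finset.exists_max_image p.support
    (fun l => w ⬝ᵥ fun k => (l k : ℝ)) (MvPolynomial.support_nonempty.2 hp)
  refine ⟨w ⬝ᵥ fun k => (l k : ℝ), ⟨⟨_, subset_convexHull ℝ _ ⟨l, hl, rfl⟩, rfl⟩, ?_⟩, ?_⟩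
  · rintro _ ⟨v, hv, rfl⟩
    have hlin : IsLinearMap ℝ fun v : Fin n → ℝ => w ⬝ᵥ v :=
      ⟨fun x y => dotProduct_add w x y, fun c x => dotProduct_smul c w x⟩
    refine convexHull_min ?_ (convex_halfSpace_le hlin (w ⬝ᵥ fun k => (l k : ℝ))) hv
    rintro _ ⟨l', hl', rfl⟩
    exact hmax l' hl'
  · have key : ∀ l : Fin n →₀ ℕ, ∏ k, Real.exp (w k) ^ l k =
        Real.exp (w ⬝ᵥ fun k => (l k : ℝ)) := by
      intro l
      rw [dotProduct, Real.exp_sum]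
      exact Finset.prod_congr rfl fun k _ => by rw [← Real.exp_nat_mul, mul_comm]
    unfold tropApprox
    simp only [key]
    have : Nonempty {l // l ∈ p.support} := ⟨⟨l, hl⟩⟩
    refine le_antisymm (ciSup_le fun l' => Real.exp_le_exp.2 (hmax l'.1 l'.2)) ?_
    exact le_ciSup (f := fun l : {l // l ∈ p.support} => Real.exp (w ⬝ᵥ fun k => (l.1 k : ℝ)))
      (Set.finite_range _).bddAbove ⟨l, hl⟩

/-- Support functions are additive under Minkowski sums and homogeneous under nonnegative scaling.
-/
theorem isGreatest_dotProduct_sum_smul {n : ℕ} {ι : Type*} [Fintype ι] {P : ι → Set (Fin n → ℝ)}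
    {c M : ι → ℝ} (hc : ∀ i, 0 ≤ c i) {w : Fin n → ℝ}
    (hM : ∀ i, IsGreatest ((fun v => w ⬝ᵥ v) '' P i) (M i)) :
    IsGreatest ((fun v => w ⬝ᵥ v) '' ∑ i, c i • P i) (∑ i, c i * M i) := by
  choose v hv hvM using fun i => (hM i).1
  constructor
  · refine ⟨∑ i, c i • v i, Set.finsetSum_mem_finsetSum _ _ _ fun i _ =>
      Set.smul_mem_smul_set (hv i), ?_⟩
    simp only [dotProduct_sum, dotProduct_smul, smul_eq_mul]
    exact Finset.sum_congr rfl fun i _ => by rw [← hvM i]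
  · rintro _ ⟨u, hu, rfl⟩
    obtain ⟨g, hg, rfl⟩ := (Set.mem_finsetSum _ _ _).1 hu
    simp only [dotProduct_sum]
    refine Finset.sum_le_sum fun i _ => ?_
    obtain ⟨x, hx, hxg⟩ := hg (Finset.mem_univ i)
    rw [← hxg]
    simp only [dotProduct_smul, smul_eq_mul]
    exact mul_le_mul_of_nonneg_left ((hM i).2 ⟨x, hx, rfl⟩) (hc i)

theorem exists_isGreatest_weightedNewtonPolytope {n : ℕ} {ι : Type*} [Fintype ι]
    {p : ι → MvPolynomial (Fin n) ℂ} (hp : ∀ i, p i ≠ 0) {c : ι → ℂ} (hc : ∀ i, 0 ≤ (c i).re)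
    (w : Fin n → ℝ) :
    ∃ M, IsGreatest ((fun v => w ⬝ᵥ v) '' weightedNewtonPolytope p c) M ∧
      ∏ i, tropApprox (p i) (fun k => Real.exp (w k)) ^ (c i).re = Real.exp M := by
  choose M hM hpM using fun i => exists_isGreatest_newtonPolytope (hp i) w
  refine ⟨_, isGreatest_dotProduct_sum_smul hc hM, ?_⟩
  rw [Real.exp_sum]
  exact Finset.prod_congr rfl fun i _ => by rw [hpM, ← Real.exp_mul, mul_comm]

/-- In logarithmic coordinates, the tropical integrand is given by a Lovász extension. -/
theorem tropIntegrand_exp {n : ℕ} [NeZero n] {ι κ : Type*} [Fintype ι] [Fintype κ]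
    {a : ι → MvPolynomial (Fin n) ℂ} {b : κ → MvPolynomial (Fin n) ℂ}
    {ν : ι → ℂ} {ρ : κ → ℂ} (ha0 : ∀ i, a i ≠ 0) (hb0 : ∀ j, b j ≠ 0)
    (hν : ∀ i, 0 ≤ (ν i).re) (hρ : ∀ j, 0 ≤ (ρ j).re)
    {zA zB : Finset (Fin n) → ℝ}
    (hzA : IsBooleanFunctionOf zA (weightedNewtonPolytope a ν))
    (hzB : IsBooleanFunctionOf zB (weightedNewtonPolytope b ρ))
    (huniv : zA Finset.univ = zB Finset.univ) (w : Fin n → ℝ) :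
    tropIntegrand a b ν ρ (fun k => Real.exp (w k)) =
      Real.exp (-lovaszSum (fun T => zA T - zB T) Finset.univ w) := by
  obtain ⟨M, hM, hMe⟩ := exists_isGreatest_weightedNewtonPolytope ha0 hν w
  obtain ⟨N, hN, hNe⟩ := exists_isGreatest_weightedNewtonPolytope hb0 hρ w
  rw [hzA.2.2] at hM
  rw [hzB.2.2] at hN
  have h1 := hM.unique (isGreatest_dotProduct_basePolytope hzA.1 hzA.2.1 w)
  have h2 := hN.unique (isGreatest_dotProduct_basePolytope hzB.1 hzB.2.1 w)
  rw [tropIntegrand, hMe, hNe, ← Real.exp_sub, h1, h2, lovaszSum_sub, huniv]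
  congr 1
  ring

/-! ### Strict inequality of boolean functions -/

theorem exists_add_smul_mem_of_mem_intrinsicInterior {E : Type*} [NormedAddCommGroup E]
    [NormedSpace ℝ E] {Q : Set E} {v d : E} (hv : v ∈ intrinsicInterior ℝ Q)
    (hd : d ∈ vectorSpan ℝ Q) : ∃ ε : ℝ, 0 < ε ∧ v + ε • d ∈ Q := by
  obtain ⟨y, hy, rfl⟩ := mem_intrinsicInterior.1 hv
  have hmem : ∀ ε : ℝ, (y : E) + ε • d ∈ affineSpan ℝ Q := by
    intro ε
    rw [add_comm]
    refine AffineSubspace.vadd_mem_of_mem_direction ?_ y.2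
    rw [direction_affineSpan]
    exact Submodule.smul_mem _ _ hd
  have hcont : Continuous fun ε : ℝ => (⟨(y : E) + ε • d, hmem ε⟩ : affineSpan ℝ Q) :=
    Continuous.subtype_mk (by fun_prop) _
  have h0 : (⟨(y : E) + (0 : ℝ) • d, hmem 0⟩ : affineSpan ℝ Q) = y := by
    ext
    simp
  have hev : ∀ᶠ ε : ℝ in nhds 0, (y : E) + ε • d ∈ Q :=
    hcont.continuousAt.eventually_mem (h0.symm ▸ mem_interior_iff_mem_nhds.1 hy)
  obtain ⟨ε, hε, hpos⟩ :=
    ((hev.filter_mono nhdsWithin_le_nhds).and (self_mem_nhdsWithin (s := Set.Ioi 0))).exists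
  exact ⟨ε, hpos, hε⟩

/-- `Q` lies in a hyperplane of constant coordinate sum, whose direction already has dimension `m`.
-/
theorem vectorSpan_eq_ker_of_finrank {m : ℕ} {Q : Set (Fin (m + 1) → ℝ)} {c : ℝ}
    (hQ : ∀ v ∈ Q, ∑ i, v i = c) (hdim : Module.finrank ℝ (vectorSpan ℝ Q) = m)
    {d : Fin (m + 1) → ℝ} (hd : ∑ i, d i = 0) : d ∈ vectorSpan ℝ Q := by
  let s : (Fin (m + 1) → ℝ) →ₗ[ℝ] ℝ := ∑ i, LinearMap.proj i
  have hs : ∀ v, s v = ∑ i, v i := fun v => by simp [s, LinearMap.sum_apply]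
  have hs0 : s ≠ 0 := fun h => by
    have := hs (Pi.single 0 1)
    simp [h] at this
  have hle : vectorSpan ℝ Q ≤ LinearMap.ker s := by
    rw [vectorSpan, Submodule.span_le]
    rintro _ ⟨x, hx, y, hy, rfl⟩
    simp [hs, hQ x hx, hQ y hy]
  have hker := Module.Dual.finrank_ker_add_one_of_ne_zero (K := ℝ) (f := s) hs0
  have heq := Submodule.eq_of_le_of_finrank_eq hle (by
    rw [hdim]
    simp only [Module.finrank_fin_fun] at hker
    omega)
  rw [heq]
  simp [hs, hd]

theorem IsBooleanFunctionOf.exists_mem_sum_eq {n : ℕ} {z : Finset (Fin n) → ℝ}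
    {P : Set (Fin n → ℝ)} (hz : IsBooleanFunctionOf z P) (T : Finset (Fin n)) :
    ∃ v ∈ P, ∑ i ∈ T, v i = z T := by
  -- The weight is the indicator of the complement of `T`, which makes `T` a strict lower set.
  obtain ⟨v, hv1, hv2⟩ := exists_greedy_vertex hz.1 hz.2.1
    (fun k => if k ∈ T then 0 else 1) Finset.univ
  refine ⟨v, ?_, hv2 T (Finset.subset_univ T) fun a ha b hb => ?_⟩
  · rw [hz.2.2]
    exact ⟨hv2 _ le_rfl (by simp), fun I => hv1 I (Finset.subset_univ I)⟩
  · simp [(Finset.mem_sdiff.1 ha).2, hb]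

theorem IsBooleanFunctionOf.univ_eq {n : ℕ} {zA zB : Finset (Fin n) → ℝ}
    {P Q : Set (Fin n → ℝ)} (hzA : IsBooleanFunctionOf zA P) (hzB : IsBooleanFunctionOf zB Q)
    (hPQ : P ⊆ Q) : zA Finset.univ = zB Finset.univ := by
  obtain ⟨v, hv, hvT⟩ := hzA.exists_mem_sum_eq Finset.univ
  have := hPQ hv
  rw [hzB.2.2] at this
  exact hvT.symm.trans this.1

/-- Take a point of `P` tight at `T`. Being relatively interior to `Q`, it can be moved inside `Q`
by some `ε > 0` along `e_j - e_i` with `i ∈ T`, `j ∉ T`. This lowers the sum over `T` to `zA T - ε`,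
which must still be at least `zB T`. -/
theorem IsBooleanFunctionOf.lt_of_subset_intrinsicInterior {m : ℕ}
    {zA zB : Finset (Fin (m + 1)) → ℝ} {P Q : Set (Fin (m + 1) → ℝ)}
    (hzA : IsBooleanFunctionOf zA P) (hzB : IsBooleanFunctionOf zB Q)
    (hdim : Module.finrank ℝ (vectorSpan ℝ Q) = m) (hPQ : P ⊆ intrinsicInterior ℝ Q)
    {T : Finset (Fin (m + 1))} (hT : T.Nonempty) (hTu : T ≠ Finset.univ) : zB T < zA T := by
  obtain ⟨v, hv, hvT⟩ := hzA.exists_mem_sum_eq T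
  obtain ⟨i, hi⟩ := hT
  obtain ⟨j, hj⟩ : ∃ j, j ∉ T := by
    by_contra! h
    exact hTu (Finset.eq_univ_iff_forall.2 h)
  have hd : Pi.single j 1 - Pi.single i 1 ∈ vectorSpan ℝ Q := by
    refine vectorSpan_eq_ker_of_finrank (c := zB Finset.univ) (fun u hu => ?_) hdim (by simp)
    rw [hzB.2.2] at hu
    exact hu.1
  obtain ⟨ε, hε, hmem⟩ := exists_add_smul_mem_of_mem_intrinsicInterior (hPQ hv) hd
  rw [hzB.2.2] at hmem
  have h := hmem.2 T
  have hsum : ∑ k ∈ T, (v + ε • (Pi.single j 1 - Pi.single i 1 : Fin (m + 1) → ℝ)) k =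
      zA T - ε := by
    simp [Finset.sum_add_distrib, hvT, Pi.single_apply,
      hi, hj, sub_eq_add_neg]
  linarith

/-! ### Marginal integrals over real coordinates -/

section Marginal

open scoped ENNReal

variable {ι : Type*} [DecidableEq ι]

/-- A marginal only sees the fibre through `x`; this allows substituting the values of the frozen
coordinates into the integrand. -/
theorem lmarginal_congr_of_forall {s : Finset ι} {f g : (ι → ℝ) → ℝ≥0∞} {x : ι → ℝ}
    (h : ∀ w, (∀ i ∉ s, w i = x i) → f w = g w) : (∫⋯∫⁻_s, f) x = (∫⋯∫⁻_s, g) x := by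
  unfold lmarginal
  refine lintegral_congr fun y => h _ fun i hi => ?_
  simp [Function.updateFinset, hi]

theorem lmarginal_finsetSum {α : Type*} (t : Finset α) {s : Finset ι}
    {f : α → (ι → ℝ) → ℝ≥0∞} (hf : ∀ i ∈ t, Measurable (f i)) (x : ι → ℝ) :
    (∫⋯∫⁻_s, fun w => ∑ i ∈ t, f i w) x = ∑ i ∈ t, (∫⋯∫⁻_s, f i) x := by
  unfold lmarginal
  exact lintegral_finsetSum t fun i hi => (hf i hi).comp measurable_updateFinset

theorem lmarginal_const_mul {s : Finset ι} {f : (ι → ℝ) → ℝ≥0∞} (hf : Measurable f) (c : ℝ≥0∞)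
    (x : ι → ℝ) : (∫⋯∫⁻_s, fun w => c * f w) x = c * (∫⋯∫⁻_s, f) x := by
  unfold lmarginal
  exact lintegral_const_mul c (hf.comp measurable_updateFinset)

/-- Integrating first over coordinate `i`, the integrand is supported at the single point `w j`. -/
theorem lmarginal_tie_eq_zero {s : Finset ι} {i j : ι} (hi : i ∈ s) (hij : i ≠ j)
    {f : (ι → ℝ) → ℝ≥0∞} (hf : Measurable f) (x : ι → ℝ) :
    (∫⋯∫⁻_s, fun w => if w i = w j then f w else 0) x = 0 := by
  have hm : Measurable fun w : ι → ℝ => if w i = w j then f w else 0 :=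
    Measurable.ite (measurableSet_eq_fun (measurable_pi_apply i) (measurable_pi_apply j)) hf
      measurable_const
  rw [lmarginal_erase' _ hm hi]
  have h0 : (fun w : ι → ℝ => ∫⁻ u, (fun w : ι → ℝ => if w i = w j then f w else 0)
      (Function.update w i u)) = fun _ => 0 := by
    funext w
    refine (lintegral_eq_zero_iff (hm.comp (measurable_update w))).2 ?_
    filter_upwards [compl_mem_ae_iff.2 (measure_singleton (w j))] with u hu
    have : u ≠ w j := hu
    simp [Function.update_of_ne hij.symm, this]
  rw [h0]
  simp [lmarginal]

/-- The vectors whose coordinate `e` is larger than all other coordinates in `B`. -/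
def strictMaxSet (B : Finset ι) (e : ι) : Set (ι → ℝ) :=
  {w | ∀ k ∈ B.erase e, w k < w e}

theorem measurableSet_strictMaxSet (B : Finset ι) (e : ι) : MeasurableSet (strictMaxSet B e) := by
  have : strictMaxSet B e = ⋂ k ∈ B.erase e, {w | w k < w e} := by
    ext
    simp [strictMaxSet]
  rw [this]
  exact Finset.measurableSet_biInter _ fun k _ =>
    measurableSet_lt (measurable_pi_apply k) (measurable_pi_apply e)

/-- Up to null sets, exactly one of the coordinates in `B` is maximal. -/
theorem lmarginal_eq_sum_strictMax {s B : Finset ι} (hB : B.Nonempty)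
    (hs : ∀ i ∈ B, ∀ j ∈ B, i ≠ j → i ∈ s ∨ j ∈ s)
    {f : (ι → ℝ) → ℝ≥0∞} (hf : Measurable f) (x : ι → ℝ) :
    (∫⋯∫⁻_s, f) x =
      ∑ e ∈ B, (∫⋯∫⁻_s, (strictMaxSet B e).indicator f) x := by
  rw [← lmarginal_finsetSum B fun e _ =>
    hf.indicator (measurableSet_strictMaxSet B e)]
  refine le_antisymm ?_ (lmarginal_mono (fun w => ?_) x)
  -- The index `none` carries the strict-maximum terms and each `some (i, j)` a tie term. By `hs`,
  -- every tie involves an integrated coordinate and so contributes zero.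
  · have hle : f ≤ fun w => ∑ p ∈ insert none (B.offDiag.map Function.Embedding.some),
        (p.elim (∑ e ∈ B, (strictMaxSet B e).indicator f w)
          fun p : ι × ι => if w p.1 = w p.2 then f w else 0) := by
      intro w
      simp only [Finset.mem_map, Function.Embedding.some_apply, reduceCtorEq, and_false,
        exists_false, not_false_eq_true, Finset.sum_insert, Option.elim, Finset.sum_map]
      obtain ⟨e, he, hmax⟩ := Finset.exists_max_image B w hB
      by_cases h : ∀ k ∈ B.erase e, w k < w e
      · refine le_add_right (le_trans ?_ (Finset.single_le_sum (fun _ _ => zero_le) he))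
        rw [Set.indicator_of_mem (show w ∈ strictMaxSet B e from h)]
      · push Not at h
        obtain ⟨k, hk, hke⟩ := h
        rw [Finset.mem_erase] at hk
        have hmem : (k, e) ∈ B.offDiag := Finset.mem_offDiag.2 ⟨hk.2, he, hk.1⟩
        refine le_add_left (le_trans ?_ (Finset.single_le_sum (fun _ _ => zero_le) hmem))
        rw [if_pos (le_antisymm (hmax k hk.2) hke)]
    refine (lmarginal_mono hle x).trans ?_
    have hmt : ∀ p : ι × ι, Measurable fun w : ι → ℝ => if w p.1 = w p.2 then f w else 0 :=
      fun p => Measurable.ite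
        (measurableSet_eq_fun (measurable_pi_apply p.1) (measurable_pi_apply p.2)) hf
        measurable_const
    rw [lmarginal_finsetSum, Finset.sum_insert (by simp), Finset.sum_map]
    · refine le_of_eq ?_
      simp only [Option.elim, Function.Embedding.some_apply]
      rw [Finset.sum_eq_zero fun p hp => ?_, add_zero]
      obtain ⟨h1, h2, h3⟩ := Finset.mem_offDiag.1 hp
      rcases hs _ h1 _ h2 h3 with h | h
      · exact lmarginal_tie_eq_zero h h3 hf x
      · refine Eq.trans (lmarginal_congr_of_forall fun w _ => ?_)
          (lmarginal_tie_eq_zero h h3.symm hf x)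
        exact if_congr eq_comm rfl rfl
    · rintro (_ | p) _
      · exact Finset.measurable_sum B fun e _ => hf.indicator (measurableSet_strictMaxSet B e)
      · exact hmt p
  · by_cases h : ∃ e ∈ B, w ∈ strictMaxSet B e
    · obtain ⟨e, he, hmax⟩ := h
      simp only
      rw [Finset.sum_eq_single_of_mem e he, Set.indicator_of_mem hmax]
      intro e' he' hne
      refine Set.indicator_of_notMem (fun h' => ?_) f
      exact lt_asymm (h' e (Finset.mem_erase.2 ⟨hne.symm, he⟩))
        (hmax e' (Finset.mem_erase.2 ⟨hne, he'⟩))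
    · push Not at h
      simp only
      rw [Finset.sum_eq_zero fun e he => Set.indicator_of_notMem (h e he) f]
      exact zero_le

theorem lmarginal_add_const {s : Finset ι} {f : (ι → ℝ) → ℝ≥0∞}
    (hinv : ∀ (c : ℝ) w, f (fun i => w i + c) = f w) (c : ℝ) (x : ι → ℝ) :
    (∫⋯∫⁻_s, f) (fun i => x i + c) = (∫⋯∫⁻_s, f) x := by
  unfold lmarginal
  rw [← volume_pi, ← lintegral_add_right_eq_self _ (fun _ : s => c)]
  refine lintegral_congr fun y => ?_
  rw [← hinv c (Function.updateFinset x s y)]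
  congr 1
  funext i
  by_cases h : i ∈ s <;> simp [Function.updateFinset, h]

/-- The integral of a translation invariant function over a chart does not depend on the chart. -/
theorem lmarginal_erase_update_eq [Fintype ι] {f : (ι → ℝ) → ℝ≥0∞} (hf : Measurable f)
    (hinv : ∀ (c : ℝ) w, f (fun i => w i + c) = f w) (e l : ι) (y : ι → ℝ) :
    (∫⋯∫⁻_(Finset.univ.erase e), f) (Function.update y e 0) =
      (∫⋯∫⁻_(Finset.univ.erase l), f) (Function.update y l 0) := by
  rcases eq_or_ne e l with rfl | hel
  · rfl
  -- Both sides become integrals over one remaining free coordinate `u`. Reflecting `u` on the left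
  -- and translating by `u` turns `(w e, w l) = (0, -u)` into `(u, 0)`.
  rw [lmarginal_erase f hf (i := l) (by simp [hel.symm]),
    lmarginal_erase f hf (i := e) (s := Finset.univ.erase l) (by simp [hel]),
    Finset.erase_right_comm, ← lintegral_neg_eq_self]
  refine lintegral_congr fun u => ?_
  rw [← lmarginal_add_const hinv u]
  refine lmarginal_congr _ _ fun i hi => ?_
  simp only [Finset.mem_erase, Finset.mem_univ, and_true, not_and_or, not_not] at hi
  rcases hi with rfl | rfl
  · simp [Function.update_of_ne hel]
  · simp [Function.update_of_ne hel.symm]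

end Marginal

/-! ### The law of the sampling loop -/

section Loop

open scoped ENNReal

variable {n : ℕ}

theorem gpJ_empty (r : Finset (Fin n) → ℝ) : gpJ r ∅ = 1 := by
  rw [gpJ, if_pos rfl]

theorem gpJ_of_nonempty (r : Finset (Fin n) → ℝ) {A : Finset (Fin n)} (hA : A.Nonempty) :
    gpJ r A = ∑ e ∈ A, gpJ r (A.erase e) / r (A.erase e) := by
  rw [gpJ, if_neg hA.ne_empty]
  exact Finset.sum_coe_sort A fun e => gpJ r (A.erase e) / r (A.erase e)

theorem gpLoop_empty (r : Finset (Fin n) → ℝ) (t : ℝ) (x : Fin n → ℝ) :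
    gpLoop r ∅ t x = Measure.dirac x := by
  rw [gpLoop, if_pos rfl]

theorem gpLoop_of_nonempty (r : Finset (Fin n) → ℝ) {A : Finset (Fin n)} (hA : A.Nonempty)
    (t : ℝ) (x : Fin n → ℝ) :
    gpLoop r A t x = ∑ e ∈ A, ENNReal.ofReal (gpProb r A e) •
      ((volume : Measure ℝ).restrict (Set.Icc 0 1)).bind fun ξ =>
        gpLoop r (A.erase e) (t * ξ ^ (1 / r (A.erase e))) (Function.update x e t) := by
  rw [gpLoop, if_neg hA.ne_empty]
  exact Finset.sum_coe_sort A fun e => ENNReal.ofReal (gpProb r A e) •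
      ((volume : Measure ℝ).restrict (Set.Icc 0 1)).bind fun ξ =>
        gpLoop r (A.erase e) (t * ξ ^ (1 / r (A.erase e))) (Function.update x e t)

theorem erase_ne_univ (A : Finset (Fin n)) (e : Fin n) : A.erase e ≠ Finset.univ := fun h =>
  Finset.notMem_erase e A (h ▸ Finset.mem_univ e)

theorem gpJ_pos {r : Finset (Fin n) → ℝ} (hr : ∀ A ≠ Finset.univ, 0 < r A) (A : Finset (Fin n)) :
    0 < gpJ r A := by
  induction A using Finset.strongInduction with
  | H A ih =>
    rcases A.eq_empty_or_nonempty with rfl | hA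
    · rw [gpJ_empty]
      exact one_pos
    · rw [gpJ_of_nonempty r hA]
      exact Finset.sum_pos (fun e he =>
        div_pos (ih _ (Finset.erase_ssubset he)) (hr _ (erase_ne_univ A e))) hA

/-- The loop is a measurable kernel in its state; this is what allows integrals against
`Measure.bind` to be unfolded. -/
theorem measurable_gpLoop_comp {α : Type} [MeasurableSpace α] (r : Finset (Fin n) → ℝ)
    (A : Finset (Fin n)) {t : α → ℝ} {x : α → Fin n → ℝ} (ht : Measurable t) (hx : Measurable x) :
    Measurable fun p => gpLoop r A (t p) (x p) := by
  suffices h : Measurable fun p : ℝ × (Fin n → ℝ) => gpLoop r A p.1 p.2 from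
    h.comp (ht.prodMk hx)
  induction A using Finset.strongInduction generalizing α with
  | H A ih =>
    rcases A.eq_empty_or_nonempty with rfl | hA
    · simp only [gpLoop_empty]
      exact Measure.measurable_dirac.comp measurable_snd
    · have hstep : ∀ e ∈ A, ∀ {β : Type} [MeasurableSpace β] {t ξ : β → ℝ} {x : β → Fin n → ℝ},
          Measurable t → Measurable ξ → Measurable x → Measurable fun p =>
          gpLoop r (A.erase e) (t p * ξ p ^ (1 / r (A.erase e)))
            (Function.update (x p) e (t p)) := by
        intro e he β _ t ξ x ht hξ hx
        have hu : Measurable fun p => Function.update (x p) e (t p) := by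
          refine measurable_pi_lambda _ fun k => ?_
          rcases eq_or_ne k e with rfl | hk
          · simpa using ht
          · simpa [Function.update_of_ne hk] using measurable_pi_iff.1 hx k
        have h := ih _ (Finset.erase_ssubset he) measurable_fst measurable_snd
          (α := ℝ × (Fin n → ℝ))
        exact h.comp ((ht.mul (hξ.pow_const _)).prodMk hu)
      refine Measure.measurable_of_measurable_coe _ fun s hs => ?_
      simp only [gpLoop_of_nonempty r hA, Measure.coe_finsetSum, Finset.sum_apply,
        Measure.smul_apply, smul_eq_mul]
      refine Finset.measurable_sum _ fun e he => Measurable.const_mul ?_ _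
      have hb : ∀ p : ℝ × (Fin n → ℝ),
          (((volume : Measure ℝ).restrict (Set.Icc 0 1)).bind fun ξ =>
            gpLoop r (A.erase e) (p.1 * ξ ^ (1 / r (A.erase e))) (Function.update p.2 e p.1)) s =
          ∫⁻ ξ in Set.Icc (0 : ℝ) 1, gpLoop r (A.erase e) (p.1 * ξ ^ (1 / r (A.erase e)))
            (Function.update p.2 e p.1) s := fun p => Measure.bind_apply hs
        (hstep e he measurable_const measurable_id measurable_const).aemeasurable
      simp only [hb]
      refine Measurable.lintegral_prod_right' (f := fun q : (ℝ × (Fin n → ℝ)) × ℝ =>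
        gpLoop r (A.erase e) (q.1.1 * q.2 ^ (1 / r (A.erase e)))
            (Function.update q.1.2 e q.1.1) s) ?_
      exact (Measure.measurable_coe hs).comp (hstep e he (measurable_fst.comp measurable_fst)
        measurable_snd (measurable_snd.comp measurable_fst))

theorem lintegral_gpLoop (r : Finset (Fin n) → ℝ) {A : Finset (Fin n)} (hA : A.Nonempty)
    (t : ℝ) (x : Fin n → ℝ) {f : (Fin n → ℝ) → ℝ≥0∞} (hf : Measurable f) :
    ∫⁻ y, f y ∂gpLoop r A t x = ∑ e ∈ A, ENNReal.ofReal (gpProb r A e) *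
      ∫⁻ ξ in Set.Icc (0 : ℝ) 1, ∫⁻ y, f y ∂gpLoop r (A.erase e) (t * ξ ^ (1 / r (A.erase e)))
        (Function.update x e t) := by
  rw [gpLoop_of_nonempty r hA, lintegral_finsetSum_measure]
  refine Finset.sum_congr rfl fun e _ => ?_
  rw [lintegral_smul_measure, smul_eq_mul, Measure.lintegral_bind _ hf.aemeasurable]
  exact (measurable_gpLoop_comp r _ (measurable_const.mul (measurable_id.pow_const _))
    measurable_const).aemeasurable

/-- The recursion for `gpJ` says precisely that the `p_e` sum to one. Only sets `A.erase e` occur as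
arguments of `r` here, and these are never all of `[n]`. -/
theorem isProbabilityMeasure_gpLoop {r : Finset (Fin n) → ℝ} (hr : ∀ A ≠ Finset.univ, 0 < r A)
    (A : Finset (Fin n)) (t : ℝ) (x : Fin n → ℝ) : IsProbabilityMeasure (gpLoop r A t x) := by
  induction A using Finset.strongInduction generalizing t x with
  | H A ih =>
    rcases A.eq_empty_or_nonempty with rfl | hA
    · rw [gpLoop_empty]
      infer_instance
    · constructor
      rw [← lintegral_one, lintegral_gpLoop r hA t x measurable_const]
      have h1 : ∀ e ∈ A, ENNReal.ofReal (gpProb r A e) *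
          ∫⁻ ξ in Set.Icc (0 : ℝ) 1, ∫⁻ _, 1 ∂gpLoop r (A.erase e)
            (t * ξ ^ (1 / r (A.erase e))) (Function.update x e t) =
          ENNReal.ofReal (gpProb r A e) := by
        intro e he
        have := ih _ (Finset.erase_ssubset he)
        simp
      have hJ := gpJ_pos hr A
      rw [Finset.sum_congr rfl h1, ← ENNReal.ofReal_sum_of_nonneg fun e _ => ?_]
      · simp only [gpProb]
        rw [← Finset.mul_sum, ← gpJ_of_nonempty r hA, one_div_mul_cancel hJ.ne',
          ENNReal.ofReal_one]
      · exact mul_nonneg (one_div_pos.2 hJ).le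
          (div_pos (gpJ_pos hr _) (hr _ (erase_ne_univ A e))).le

/-- Substitute `ξ = exp (q * (s - τ))`: the logarithm of the updated factor lies below `τ` by an
exponential variable of rate `q`. -/
theorem lintegral_Icc_mul_rpow {q : ℝ} (hq : 0 < q) (τ : ℝ) (G : ℝ → ℝ≥0∞) :
    ∫⁻ ξ in Set.Icc (0 : ℝ) 1, G (Real.exp τ * ξ ^ (1 / q)) =
      ∫⁻ s in Set.Iio τ, ENNReal.ofReal (q * Real.exp (q * (s - τ))) * G (Real.exp s) := by
  have himg : (fun s => Real.exp (q * (s - τ))) '' Set.Iio τ = Set.Ioo 0 1 := by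
    ext ξ
    simp only [Set.mem_image, Set.mem_Iio, Set.mem_Ioo]
    constructor
    · rintro ⟨s, hs, rfl⟩
      exact ⟨Real.exp_pos _, Real.exp_lt_one_iff.2 (mul_neg_of_pos_of_neg hq (sub_neg.2 hs))⟩
    · rintro ⟨h0, h1⟩
      refine ⟨τ + Real.log ξ / q, ?_, ?_⟩
      · linarith [div_neg_of_neg_of_pos (Real.log_neg h0 h1) hq]
      · rw [add_sub_cancel_left, mul_div_cancel₀ _ hq.ne', Real.exp_log h0]
  have hderiv : ∀ s ∈ Set.Iio τ, HasDerivWithinAt (fun s => Real.exp (q * (s - τ)))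
      (Real.exp (q * (s - τ)) * (q * 1)) (Set.Iio τ) s := fun s _ =>
    (((hasDerivAt_id s).sub_const τ).const_mul q).exp.hasDerivWithinAt
  have hinj : Set.InjOn (fun s => Real.exp (q * (s - τ))) (Set.Iio τ) := by
    intro s _ u _ h
    have := mul_left_cancel₀ hq.ne' (Real.exp_injective h)
    linarith
  rw [← setLIntegral_congr (Ioo_ae_eq_Icc (μ := volume)), ← himg,
    lintegral_image_eq_lintegral_abs_deriv_mul measurableSet_Iio hderiv hinj]
  refine lintegral_congr fun s => ?_
  have h1 : Real.exp τ * Real.exp (q * (s - τ)) ^ (1 / q) = Real.exp s := by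
    rw [← Real.exp_mul, ← Real.exp_add]
    congr 1
    field_simp
    ring
  rw [h1, abs_of_pos (by positivity), mul_one, mul_comm (Real.exp _)]

/-- The density of the sampling loop in logarithmic coordinates, weighted by a test function. -/
def loopDensity (r : Finset (Fin n) → ℝ) (f : (Fin n → ℝ) → ℝ≥0∞) (A : Finset (Fin n))
    (w : Fin n → ℝ) : ℝ≥0∞ :=
  f (fun k => Real.exp (w k)) * ENNReal.ofReal (Real.exp (-lovaszSum r A w))

theorem measurable_loopDensity (r : Finset (Fin n) → ℝ) {f : (Fin n → ℝ) → ℝ≥0∞}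
    (hf : Measurable f) (A : Finset (Fin n)) : Measurable (loopDensity r f A) := by
  refine Measurable.mul (hf.comp ?_) ?_
  · exact measurable_pi_lambda _ fun k => Real.measurable_exp.comp (measurable_pi_apply k)
  · exact (Real.continuous_exp.comp (continuous_lovaszSum r A).neg).measurable.ennreal_ofReal

/-- When `e` is largest and `e'` second largest, `lovaszSum_insert` splits off the single factor
depending on the gap `w e - w e'`. -/
theorem loopDensity_strictMax_erase (r : Finset (Fin n) → ℝ) (f : (Fin n → ℝ) → ℝ≥0∞)
    {A : Finset (Fin n)} {e e' : Fin n} (he : e ∈ A) (he' : e' ∈ A.erase e) (w : Fin n → ℝ) :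
    (strictMaxSet (A.erase e) e').indicator
        ((strictMaxSet A e).indicator (loopDensity r f A)) w =
      (Set.Iio (w e)).indicator (fun s => ENNReal.ofReal (Real.exp (r (A.erase e) * (s - w e))))
        (w e') * (strictMaxSet (A.erase e) e').indicator (loopDensity r f (A.erase e)) w := by
  by_cases h1 : w ∈ strictMaxSet (A.erase e) e'
  · rw [Set.indicator_of_mem h1, Set.indicator_of_mem h1]
    have hle : ∀ k ∈ A.erase e, w k ≤ w e' := fun k hk => by
      rcases eq_or_ne k e' with rfl | hk'
      · exact le_rfl
      · exact (h1 k (Finset.mem_erase.2 ⟨hk', hk⟩)).le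
    by_cases h2 : w e' < w e
    · have h3 : ∀ k ∈ A.erase e, w k < w e := fun k hk => (hle k hk).trans_lt h2
      rw [Set.indicator_of_mem (show w ∈ strictMaxSet A e from h3),
        Set.indicator_of_mem (show w e' ∈ Set.Iio (w e) from h2)]
      have hsup : (A.erase e).sup' ⟨e', he'⟩ w = w e' :=
        le_antisymm (Finset.sup'_le _ w hle) (Finset.le_sup' w he')
      have hlov := lovaszSum_insert r (Finset.notMem_erase e A) ⟨e', he'⟩ fun k hk => (h3 k hk).le
      rw [Finset.insert_erase he, hsup] at hlov
      unfold loopDensity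
      rw [hlov, mul_left_comm, ← ENNReal.ofReal_mul (Real.exp_pos _).le, ← Real.exp_add]
      congr 3
      ring
    · rw [Set.indicator_of_notMem (show w e' ∉ Set.Iio (w e) from h2),
        Set.indicator_of_notMem fun h : w ∈ strictMaxSet A e => h2 (h e' he'), zero_mul]
  · rw [Set.indicator_of_notMem h1, Set.indicator_of_notMem h1, mul_zero]

/-- Split according to the second largest coordinate `e'` and integrate its value `s < τ` last. This
mirrors one pass of the loop. -/
theorem lmarginal_loopDensity_erase (r : Finset (Fin n) → ℝ) {f : (Fin n → ℝ) → ℝ≥0∞}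
    (hf : Measurable f) {A : Finset (Fin n)} {e : Fin n} (he : e ∈ A) (hne : (A.erase e).Nonempty)
    (y : Fin n → ℝ) (τ : ℝ) :
    (∫⋯∫⁻_(A.erase e), (strictMaxSet A e).indicator (loopDensity r f A))
        (Function.update y e τ) =
      ∫⁻ s in Set.Iio τ, ENNReal.ofReal (Real.exp (r (A.erase e) * (s - τ))) *
        ∑ e' ∈ A.erase e, (∫⋯∫⁻_((A.erase e).erase e'), (strictMaxSet (A.erase e) e').indicator (loopDensity r f (A.erase e)))
            (Function.update (Function.update y e τ) e' s) := by
  have hm := (measurable_loopDensity r hf A).indicator (measurableSet_strictMaxSet A e)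
  have hms := fun e' => (measurable_loopDensity r hf (A.erase e)).indicator
    (measurableSet_strictMaxSet (A.erase e) e')
  rw [lmarginal_eq_sum_strictMax hne (fun i hi _ _ _ => Or.inl hi) hm,
    ← lintegral_indicator measurableSet_Iio]
  simp only [Finset.mul_sum]
  have hsum : ∀ s, (Set.Iio τ).indicator (fun s => ∑ e' ∈ A.erase e,
      ENNReal.ofReal (Real.exp (r (A.erase e) * (s - τ))) *
        (∫⋯∫⁻_((A.erase e).erase e'), (strictMaxSet (A.erase e) e').indicator (loopDensity r f (A.erase e)))
            (Function.update (Function.update y e τ) e' s)) s = ∑ e' ∈ A.erase e,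
      (Set.Iio τ).indicator (fun s => ENNReal.ofReal (Real.exp (r (A.erase e) * (s - τ)))) s *
        (∫⋯∫⁻_((A.erase e).erase e'), (strictMaxSet (A.erase e) e').indicator (loopDensity r f (A.erase e)))
            (Function.update (Function.update y e τ) e' s) := by
    intro s
    by_cases hs : s ∈ Set.Iio τ <;> simp [hs]
  simp only [hsum]
  rw [lintegral_finsetSum]
  · refine Finset.sum_congr rfl fun e' he' => ?_
    rw [lmarginal_erase _ (hm.indicator (measurableSet_strictMaxSet _ e')) he']
    refine lintegral_congr fun s => ?_
    rw [← lmarginal_const_mul (hms e')]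
    refine lmarginal_congr_of_forall fun w hw => ?_
    have hwe' : w e' = s := by
      rw [hw e' (Finset.notMem_erase _ _), Function.update_self]
    have hwe : w e = τ := by
      rw [hw e (by simp), Function.update_of_ne (Finset.ne_of_mem_erase he').symm,
        Function.update_self]
    rw [loopDensity_strictMax_erase r f he he', hwe, hwe']
  · intro e' _
    refine Measurable.mul (Measurable.indicator ?_ measurableSet_Iio) ?_
    · fun_prop
    · exact ((hms e').lmarginal _).comp (measurable_update _)

/-- The law of the loop in logarithmic coordinates. -/
theorem gpJ_mul_lintegral_gpLoop {r : Finset (Fin n) → ℝ} (hr0 : r ∅ = 1)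
    (hr : ∀ A ≠ Finset.univ, 0 < r A) {f : (Fin n → ℝ) → ℝ≥0∞} (hf : Measurable f)
    {A : Finset (Fin n)} (hA : A.Nonempty) {x y : Fin n → ℝ}
    (hxy : ∀ k ∉ A, x k = Real.exp (y k)) (τ : ℝ) :
    ENNReal.ofReal (gpJ r A) * ∫⁻ u, f u ∂gpLoop r A (Real.exp τ) x =
      ∑ e ∈ A, (∫⋯∫⁻_(A.erase e), (strictMaxSet A e).indicator (loopDensity r f A))
          (Function.update y e τ) := by
  induction A using Finset.strongInduction generalizing x y τ with
  | H A ih =>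
    have hupd : ∀ e ∈ A, ∀ k ∉ A.erase e,
        Function.update x e (Real.exp τ) k = Real.exp (Function.update y e τ k) := by
      intro e he k hk
      rcases eq_or_ne k e with rfl | hke
      · simp
      · rw [Function.update_of_ne hke, Function.update_of_ne hke]
        exact hxy k fun h => hk (Finset.mem_erase.2 ⟨hke, h⟩)
    rw [lintegral_gpLoop r hA _ _ hf, Finset.mul_sum]
    refine Finset.sum_congr rfl fun e he => ?_
    have hprob : ENNReal.ofReal (gpJ r A) * ENNReal.ofReal (gpProb r A e) =
        ENNReal.ofReal (gpJ r (A.erase e) / r (A.erase e)) := by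
      rw [← ENNReal.ofReal_mul (gpJ_pos hr A).le, gpProb, ← mul_assoc,
        mul_one_div_cancel (gpJ_pos hr A).ne', one_mul]
    rw [← mul_assoc, hprob]
    rcases (A.erase e).eq_empty_or_nonempty with hs | hs
    -- Last pass: no gap remains, and `r ∅ = 1` makes the weight trivial.
    · obtain rfl : A = {e} := by
        rw [← Finset.insert_erase he, hs]
        rfl
      have hx : Function.update x e (Real.exp τ) = fun k => Real.exp (Function.update y e τ k) :=
        funext fun k => hupd e he k (by simp [hs])
      have hmem : Function.update y e τ ∈ strictMaxSet {e} e := by simp [strictMaxSet]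
      simp [hs, gpJ_empty, hr0, gpLoop_empty, lintegral_dirac' _ hf, loopDensity,
        lovaszSum_singleton, hx, Set.indicator_of_mem hmem]
    · have hq := hr _ (erase_ne_univ A e)
      rw [lmarginal_loopDensity_erase r hf he hs, lintegral_Icc_mul_rpow hq τ fun t =>
          ∫⁻ u, f u ∂gpLoop r (A.erase e) t (Function.update x e (Real.exp τ)),
        ← lintegral_const_mul' _ _ ENNReal.ofReal_ne_top]
      refine lintegral_congr fun s => ?_
      -- The rate in the exponential density cancels the denominator `r (A.erase e)` left over from
      -- `p_e`.
      rw [← ih _ (Finset.erase_ssubset he) hs (hupd e he) s, ← mul_assoc, ← mul_assoc,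
        ← ENNReal.ofReal_mul (div_pos (gpJ_pos hr _) hq).le,
        ← ENNReal.ofReal_mul (Real.exp_pos _).le]
      congr 2
      field_simp

end Loop

/-! ### The positive part of projective space in logarithmic coordinates -/

section Projective

open scoped ENNReal

variable {m : ℕ}

theorem measurableSet_forall_pos (n : ℕ) : MeasurableSet {x : Fin n → ℝ | ∀ k, 0 < x k} := by
  simp only [Set.ofPred_forall]
  exact MeasurableSet.iInter fun k => measurableSet_lt measurable_const (measurable_pi_apply k)

theorem toPosProj_of_pos {x : Fin (m + 1) → ℝ} (hx : ∀ k, 0 < x k) :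
    toPosProj x = PosProj.mk x hx :=
  dif_pos hx

theorem measurable_toPosProj (m : ℕ) :
    Measurable (toPosProj : (Fin (m + 1) → ℝ) → PosProj m) := by
  classical
  have hpos : ∀ x : Fin (m + 1) → ℝ, ∀ k,
      0 < (if ∀ k, 0 < x k then x else fun _ => (1 : ℝ)) k := by
    intro x k
    split_ifs with h
    · exact h k
    · exact one_pos
  have hm : Measurable fun x : Fin (m + 1) → ℝ =>
      if ∀ k, 0 < x k then x else fun _ => (1 : ℝ) :=
    Measurable.ite (measurableSet_forall_pos _) measurable_id measurable_const
  have hmk : Measurable (Projectivization.mk' ℝ : {v : Fin (m + 1) → ℝ // v ≠ 0} → _) :=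
    fun _ hs => hs
  have hcomp := hmk.comp (hm.subtype_mk (h := fun x => ne_zero_of_all_pos (hpos x)))
  have hsub : Measurable fun x => PosProj.mk _ (hpos x) := hcomp.subtype_mk
  convert hsub using 1
  funext x
  by_cases h : ∀ k, 0 < x k
  · rw [toPosProj_of_pos h]
    simp [h, PosProj.mk]
  · simp [toPosProj, h, PosProj.mk]

theorem Projectivization.rep_mk_div_rep_mk {x : Fin (m + 1) → ℝ} (hx : x ≠ 0)
    (k l : Fin (m + 1)) :
    (Projectivization.mk ℝ x hx).rep k / (Projectivization.mk ℝ x hx).rep l = x k / x l := by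
  obtain ⟨c, hc⟩ := Projectivization.exists_smul_eq_mk_rep ℝ x hx
  have h : ∀ k, (Projectivization.mk ℝ x hx).rep k = c * x k := fun k => by
    rw [← hc]
    rfl
  rw [h, h, mul_div_mul_left _ _ c.ne_zero]

/-- `rep` is an arbitrary choice of representative, but ratios of its coordinates do not depend on
it, so measurability can be checked on nonzero vectors. -/
theorem measurable_affineRep (m : ℕ) :
    Measurable (PosProj.affineRep : PosProj m → Fin (m + 1) → ℝ) := by
  refine measurable_pi_lambda _ fun k => ?_
  have h : Measurable fun p : Projectivization ℝ (Fin (m + 1) → ℝ) =>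
      p.rep k / p.rep (Fin.last m) := by
    intro s hs
    change MeasurableSet ((Projectivization.mk' ℝ : {v : Fin (m + 1) → ℝ // v ≠ 0} → _) ⁻¹' _)
    have h' : Measurable fun v : {v : Fin (m + 1) → ℝ // v ≠ 0} => v.1 k / v.1 (Fin.last m) :=
      ((measurable_pi_apply k).comp measurable_subtype_coe).div
        ((measurable_pi_apply _).comp measurable_subtype_coe)
    convert h' hs using 1
    ext v
    simp [Projectivization.rep_mk_div_rep_mk]
  exact h.comp measurable_subtype_coe

theorem toPosProj_exp_add_const (w : Fin (m + 1) → ℝ) (c : ℝ) :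
    toPosProj (fun k => Real.exp (w k + c)) = toPosProj fun k => Real.exp (w k) := by
  rw [toPosProj_of_pos fun k => Real.exp_pos _, toPosProj_of_pos fun k => Real.exp_pos _]
  refine Subtype.ext ((Projectivization.mk_eq_mk_iff' ℝ _ _ _ _).2 ⟨Real.exp c, ?_⟩)
  funext k
  simp [Real.exp_add, mul_comm]

theorem affineRep_toPosProj_exp (w : Fin (m + 1) → ℝ) :
    (toPosProj fun k => Real.exp (w k)).affineRep =
      (Real.exp (w (Fin.last m)))⁻¹ • fun k => Real.exp (w k) := by
  rw [toPosProj_of_pos fun k => Real.exp_pos _]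
  funext k
  simp only [PosProj.affineRep, PosProj.mk, Projectivization.rep_mk_div_rep_mk, Pi.smul_apply,
    smul_eq_mul]
  rw [div_eq_inv_mul]

/-- The Jacobian of the coordinatewise exponential is `∏ k, exp (w k)`, which cancels the density `∏
k, (x k)⁻¹`. -/
theorem setLIntegral_pos_eq_lintegral_exp {n : ℕ} (g : (Fin n → ℝ) → ℝ≥0∞) :
    ∫⁻ x in {x : Fin n → ℝ | ∀ k, 0 < x k}, ENNReal.ofReal (∏ k, (x k)⁻¹) * g x =
      ∫⁻ w : Fin n → ℝ, g fun k => Real.exp (w k) := by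
  have himg : (fun (w : Fin n → ℝ) k => Real.exp (w k)) '' Set.univ = {x | ∀ k, 0 < x k} := by
    ext x
    simp only [Set.image_univ, Set.mem_range, Set.mem_ofPred_eq]
    constructor
    · rintro ⟨w, rfl⟩ k
      exact Real.exp_pos _
    · exact fun h => ⟨fun k => Real.log (x k), funext fun k => Real.exp_log (h k)⟩
  let D : (Fin n → ℝ) → (Fin n → ℝ) →L[ℝ] (Fin n → ℝ) := fun w =>
    ContinuousLinearMap.pi fun k => Real.exp (w k) • ContinuousLinearMap.proj k
  have hD : ∀ w ∈ Set.univ, HasFDerivWithinAt (fun (w : Fin n → ℝ) k => Real.exp (w k)) (D w)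
      Set.univ w := by
    intro w _
    refine HasFDerivAt.hasFDerivWithinAt (hasFDerivAt_pi.2 fun k => ?_)
    exact (hasFDerivAt_apply k w).exp
  have hdet : ∀ w, (D w).det = ∏ k, Real.exp (w k) := by
    intro w
    have h : (D w : (Fin n → ℝ) →ₗ[ℝ] (Fin n → ℝ)) =
        Matrix.toLin' (Matrix.diagonal fun k => Real.exp (w k)) := by
      ext v k
      simp [D, Matrix.mulVec_diagonal]
    rw [ContinuousLinearMap.det, h, LinearMap.det_toLin', Matrix.det_diagonal]
  have hinj : Set.InjOn (fun (w : Fin n → ℝ) k => Real.exp (w k)) Set.univ :=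
    fun v _ w _ h => funext fun k => Real.exp_injective (congrFun h k)
  rw [← himg, lintegral_image_eq_lintegral_abs_det_fderiv_mul volume MeasurableSet.univ hD hinj,
    Measure.restrict_univ]
  refine lintegral_congr fun w => ?_
  have hp : 0 < ∏ k, Real.exp (w k) := Finset.prod_pos fun k _ => Real.exp_pos _
  rw [hdet, abs_of_pos hp, ← mul_assoc, ← ENNReal.ofReal_mul hp.le, ← Finset.prod_mul_distrib,
    Finset.prod_eq_one fun k _ => mul_inv_cancel₀ (Real.exp_ne_zero _), ENNReal.ofReal_one, one_mul]

theorem image_castSucc_univ (m : ℕ) :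
    (Finset.univ : Finset (Fin m)).image Fin.castSucc = Finset.univ.erase (Fin.last m) := by
  ext k
  refine Fin.lastCases ?_ (fun i => ?_) k
  · simp
  · simp

theorem lintegral_canonicalMeasure {F : PosProj m → ℝ≥0∞} (hF : Measurable F)
    (y : Fin (m + 1) → ℝ) :
    ∫⁻ p, F p ∂canonicalMeasure m =
      (∫⋯∫⁻_(Finset.univ.erase (Fin.last m)), fun w => F (toPosProj fun k => Real.exp (w k)))
        (Function.update y (Fin.last m) 0) := by
  have hsnoc : ∀ c : ℝ, Measurable fun x : Fin m → ℝ => (Fin.snoc x c : Fin (m + 1) → ℝ) := by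
    intro c
    refine measurable_pi_lambda _ fun k => ?_
    refine Fin.lastCases ?_ (fun i => ?_) k
    · simp
    · simpa using measurable_pi_apply i
  have hpos : ∀ x : {x : Fin m → ℝ // ∀ k, 0 < x k}, ∀ k,
      0 < (Fin.snoc x.1 1 : Fin (m + 1) → ℝ) k := by
    intro x k
    refine Fin.lastCases ?_ (fun i => ?_) k
    · simp
    · simpa using x.2 i
  have hchart : affineChart m = fun x => toPosProj (Fin.snoc x.1 1) :=
    funext fun x => (toPosProj_of_pos (hpos x)).symm
  have hchartm : Measurable (affineChart m) := by
    rw [hchart]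
    exact (measurable_toPosProj m).comp ((hsnoc 1).comp measurable_subtype_coe)
  have hdens : Measurable fun x : Fin m → ℝ => ENNReal.ofReal (∏ k, (x k)⁻¹) :=
    (Finset.measurable_prod _ fun k _ => (measurable_pi_apply k).inv).ennreal_ofReal
  have hFm : Measurable fun x : Fin m → ℝ => F (toPosProj (Fin.snoc x 1)) :=
    hF.comp ((measurable_toPosProj m).comp (hsnoc 1))
  rw [canonicalMeasure, lintegral_map hF hchartm, hchart]
  refine (lintegral_subtype_comap (measurableSet_forall_pos m)
    (fun x : Fin m → ℝ => F (toPosProj (Fin.snoc x 1)))).trans ?_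
  rw [restrict_withDensity (measurableSet_forall_pos m),
    lintegral_withDensity_eq_lintegral_mul _ hdens hFm]
  refine (setLIntegral_pos_eq_lintegral_exp fun x => F (toPosProj (Fin.snoc x 1))).trans ?_
  have hexp : ∀ w : Fin m → ℝ, (Fin.snoc (fun k => Real.exp (w k)) 1 : Fin (m + 1) → ℝ) =
      fun k => Real.exp ((Fin.snoc w 0 : Fin (m + 1) → ℝ) k) := by
    intro w
    funext k
    refine Fin.lastCases ?_ (fun i => ?_) k <;> simp
  have hexpm : Measurable fun w : Fin m → ℝ =>
      F (toPosProj fun k => Real.exp ((Fin.snoc w 0 : Fin (m + 1) → ℝ) k)) := by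
    refine hF.comp ((measurable_toPosProj m).comp (measurable_pi_lambda _ fun k => ?_))
    exact Real.measurable_exp.comp ((measurable_pi_apply k).comp (hsnoc 0))
  simp only [hexp]
  have himage := lmarginal_image (μ := fun _ : Fin (m + 1) => (volume : Measure ℝ))
    (Fin.castSucc_injective m) Finset.univ hexpm (Function.update y (Fin.last m) 0)
  rw [image_castSucc_univ, lmarginal_univ] at himage
  rw [volume_pi]
  refine himage.symm.trans (lmarginal_congr_of_forall fun w hw => ?_)
  have hlast : w (Fin.last m) = 0 := by
    rw [hw _ (Finset.notMem_erase _ _), Function.update_self]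
  have hw' : (Fin.snoc (fun i : Fin m => w i.castSucc) 0 : Fin (m + 1) → ℝ) = w := by
    rw [← hlast]
    exact Fin.snoc_init_self w
  simp only [Function.comp_apply]
  exact congrArg (fun v : Fin (m + 1) → ℝ => F (toPosProj fun k => Real.exp (v k))) hw'

end Projective

/-! ### The tropical measure -/

section Tropical

open scoped ENNReal

variable {m : ℕ} {ι κ : Type*} [Fintype ι] [Fintype κ]
  {a : ι → MvPolynomial (Fin (m + 1)) ℂ} {b : κ → MvPolynomial (Fin (m + 1)) ℂ}
  {ν : ι → ℂ} {ρ : κ → ℂ}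

theorem measurable_tropApprox {n : ℕ} (p : MvPolynomial (Fin n) ℂ) : Measurable (tropApprox p) :=
  Measurable.iSup fun _ => Finset.measurable_prod _ fun k _ => (measurable_pi_apply k).pow_const _

theorem measurable_tropDensity : Measurable (tropDensity a b ν ρ) := by
  have h : Measurable (tropIntegrand a b ν ρ) :=
    (Finset.measurable_prod _ fun i _ => (measurable_tropApprox (a i)).pow_const _).div
      (Finset.measurable_prod _ fun j _ => (measurable_tropApprox (b j)).pow_const _)
  exact (h.comp (measurable_affineRep m)).ennreal_ofReal

theorem tropDensity_toPosProj_exp (ha : ∀ i, (a i).IsHomogeneous (a i).totalDegree)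
    (hb : ∀ j, (b j).IsHomogeneous (b j).totalDegree)
    (hdeg : ∑ i, ν i * ((a i).totalDegree : ℂ) = ∑ j, ρ j * ((b j).totalDegree : ℂ))
    (w : Fin (m + 1) → ℝ) :
    tropDensity a b ν ρ (toPosProj fun k => Real.exp (w k)) =
      ENNReal.ofReal (tropIntegrand a b ν ρ fun k => Real.exp (w k)) := by
  rw [tropDensity, affineRep_toPosProj_exp, tropIntegrand_smul ha hb hdeg
    (fun k => Real.exp_pos _) (inv_pos.2 (Real.exp_pos _))]

/-- The law of the algorithm, up to normalization. -/
theorem gpJ_mul_lintegral_toPosProj {r : Finset (Fin (m + 1)) → ℝ} (hr0 : r ∅ = 1)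
    (hr : ∀ A ≠ Finset.univ, 0 < r A)
    (hdens : ∀ w : Fin (m + 1) → ℝ, tropDensity a b ν ρ (toPosProj fun k => Real.exp (w k)) =
      ENNReal.ofReal (Real.exp (-lovaszSum r Finset.univ w)))
    {F : PosProj m → ℝ≥0∞} (hF : Measurable F) :
    ENNReal.ofReal (gpJ r Finset.univ) * ∫⁻ x, F (toPosProj x) ∂gpSampling r =
      ∫⁻ p, F p * tropDensity a b ν ρ p ∂canonicalMeasure m := by
  have hloop := gpJ_mul_lintegral_gpLoop (x := 0) (y := 0) hr0 hr
    (hF.comp (measurable_toPosProj m)) Finset.univ_nonempty (by simp) 0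
  rw [Real.exp_zero] at hloop
  have hm := measurable_loopDensity r (hF.comp (measurable_toPosProj m)) Finset.univ
  have hH : (fun w : Fin (m + 1) → ℝ => F (toPosProj fun k => Real.exp (w k)) *
      tropDensity a b ν ρ (toPosProj fun k => Real.exp (w k))) =
      loopDensity r (F ∘ toPosProj) Finset.univ :=
    funext fun w => by rw [hdens, loopDensity, Function.comp_apply]
  have hinv : ∀ (c : ℝ) w, loopDensity r (F ∘ toPosProj) Finset.univ (fun i => w i + c) =
      loopDensity r (F ∘ toPosProj) Finset.univ w := by
    intro c w
    rw [← hH]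
    simp only [toPosProj_exp_add_const]
  refine Eq.trans hloop
    (Eq.trans ?_ (lintegral_canonicalMeasure (hF.mul measurable_tropDensity) 0).symm)
  simp only [Pi.mul_apply]
  rw [hH, lmarginal_eq_sum_strictMax Finset.univ_nonempty (fun i _ j _ hij => ?_) hm]
  -- Each summand is invariant under translation along `(1, …, 1)`, so the chart `w e = 0` may be
  -- exchanged for the chart where the last coordinate vanishes.
  · refine Finset.sum_congr rfl fun e _ => ?_
    refine lmarginal_erase_update_eq (hm.indicator (measurableSet_strictMaxSet _ e)) ?_ _ _ _
    intro c w
    have hmem : (fun i => w i + c) ∈ strictMaxSet Finset.univ e ↔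
        w ∈ strictMaxSet Finset.univ e := by
      simp [strictMaxSet]
    by_cases hw : w ∈ strictMaxSet Finset.univ e
    · rw [Set.indicator_of_mem hw, Set.indicator_of_mem (hmem.2 hw), hinv]
    · rw [Set.indicator_of_notMem hw, Set.indicator_of_notMem (mt hmem.1 hw)]
  · simp only [Finset.mem_erase, Finset.mem_univ, and_true]
    by_contra! h
    exact hij (h.1.trans h.2.symm)

/-- Test the law on the indicator of the complement: the logarithmic formula evaluates it only at
vectors of exponentials, where it vanishes. -/
theorem ae_gpSampling_pos {r : Finset (Fin (m + 1)) → ℝ} (hr0 : r ∅ = 1)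
    (hr : ∀ A ≠ Finset.univ, 0 < r A) : ∀ᵐ x ∂gpSampling r, ∀ k, 0 < x k := by
  have hs := (measurableSet_forall_pos (m + 1)).compl
  have h := gpJ_mul_lintegral_gpLoop (x := 0) (y := 0) hr0 hr
    (measurable_one.indicator hs) Finset.univ_nonempty (by simp) 0
  have h0 : ∀ w, loopDensity r ({x : Fin (m + 1) → ℝ | ∀ k, 0 < x k}ᶜ.indicator 1)
      Finset.univ w = 0 := by
    intro w
    simp [loopDensity, Real.exp_pos]
  have h1 : loopDensity r ({x : Fin (m + 1) → ℝ | ∀ k, 0 < x k}ᶜ.indicator 1) Finset.univ = 0 :=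
    funext h0
  rw [h1, Real.exp_zero, lintegral_indicator_one hs] at h
  simp only [Set.indicator_zero', lmarginal, Pi.zero_apply, lintegral_zero, Finset.sum_const_zero,
    mul_eq_zero, ENNReal.ofReal_eq_zero, not_le.2 (gpJ_pos hr _), false_or] at h
  exact h

theorem map_gpSampling_eq_tropMeasure {r : Finset (Fin (m + 1)) → ℝ} (hr0 : r ∅ = 1)
    (hr : ∀ A ≠ Finset.univ, 0 < r A)
    (hdens : ∀ w : Fin (m + 1) → ℝ, tropDensity a b ν ρ (toPosProj fun k => Real.exp (w k)) =
      ENNReal.ofReal (Real.exp (-lovaszSum r Finset.univ w))) :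
    (gpSampling r).map toPosProj = tropMeasure a b ν ρ := by
  have hprob : IsProbabilityMeasure (gpSampling r) := isProbabilityMeasure_gpLoop hr _ _ _
  -- The constant test function `1` identifies the normalization, and shows that it is finite and
  -- nonzero.
  have hI : tropIntegral a b ν ρ = ENNReal.ofReal (gpJ r Finset.univ) := by
    have h := gpJ_mul_lintegral_toPosProj hr0 hr hdens (F := fun _ => 1) measurable_const
    simpa [tropIntegral] using h.symm
  have hJ0 : ENNReal.ofReal (gpJ r Finset.univ) ≠ 0 := by
    simpa using gpJ_pos hr Finset.univ
  ext S hS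
  have h := gpJ_mul_lintegral_toPosProj hr0 hr hdens (F := S.indicator 1)
    (measurable_one.indicator hS)
  have h1 : ∫⁻ x, S.indicator 1 (toPosProj x) ∂gpSampling r =
      (gpSampling r).map toPosProj S := by
    rw [← lintegral_map (measurable_one.indicator hS) (measurable_toPosProj m),
      lintegral_indicator_one hS]
  have h2 : ∫⁻ p, S.indicator 1 p * tropDensity a b ν ρ p ∂canonicalMeasure m =
      (canonicalMeasure m).withDensity (tropDensity a b ν ρ) S := by
    rw [withDensity_apply _ hS, ← lintegral_indicator hS]
    refine lintegral_congr fun p => ?_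
    by_cases hp : p ∈ S <;> simp [hp]
  rw [h1, h2] at h
  rw [tropMeasure, hI, Measure.smul_apply, smul_eq_mul, ← h, ← mul_assoc,
    ENNReal.inv_mul_cancel hJ0 ENNReal.ofReal_ne_top, one_mul]

end Tropical

end

theorem mainTheorem6 (m : ℕ) {ι κ : Type*} [Fintype ι] [Fintype κ]
    (a : ι → MvPolynomial (Fin (m + 1)) ℂ) (b : κ → MvPolynomial (Fin (m + 1)) ℂ)
    (ν : ι → ℂ) (ρ : κ → ℂ)
    (ha0 : ∀ i, a i ≠ 0) (hb0 : ∀ j, b j ≠ 0)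
    (ha : ∀ i, (a i).IsHomogeneous (a i).totalDegree)
    (hb : ∀ j, (b j).IsHomogeneous (b j).totalDegree)
    (hdeg : ∑ i, ν i * ((a i).totalDegree : ℂ) = ∑ j, ρ j * ((b j).totalDegree : ℂ))
    (hν : ∀ i, 0 ≤ (ν i).re) (hρ : ∀ j, 0 ≤ (ρ j).re)
    (hR1 : Module.finrank ℝ (vectorSpan ℝ (weightedNewtonPolytope b ρ)) = m)
    (hR2 : weightedNewtonPolytope a ν ⊆ intrinsicInterior ℝ (weightedNewtonPolytope b ρ))
    (hA : IsGeneralizedPermutahedron (weightedNewtonPolytope a ν))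
    (hB : IsGeneralizedPermutahedron (weightedNewtonPolytope b ρ))
    (zA zB : Finset (Fin (m + 1)) → ℝ)
    (hzA : IsBooleanFunctionOf zA (weightedNewtonPolytope a ν))
    (hzB : IsBooleanFunctionOf zB (weightedNewtonPolytope b ρ))
    (r : Finset (Fin (m + 1)) → ℝ) (hr0 : r ∅ = 1)
    (hr : ∀ A : Finset (Fin (m + 1)), A.Nonempty → A ≠ Finset.univ → r A = zA A - zB A) :
    (∀ A : Finset (Fin (m + 1)), A.Nonempty → A ≠ Finset.univ → 0 < r A) ∧
    IsProbabilityMeasure (gpSampling r) ∧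
    (∀ᵐ x ∂gpSampling r, ∀ k, 0 < x k) ∧
    (gpSampling r).map toPosProj = tropMeasure a b ν ρ := by
  have hpos : ∀ A : Finset (Fin (m + 1)), A.Nonempty → A ≠ Finset.univ → 0 < r A := by
    intro A h1 h2
    rw [hr A h1 h2]
    exact sub_pos.2 (hzA.lt_of_subset_intrinsicInterior hzB hR1 hR2 h1 h2)
  have hpos' : ∀ A ≠ Finset.univ, 0 < r A := by
    intro A hA
    rcases A.eq_empty_or_nonempty with rfl | h
    · rw [hr0]
      exact one_pos
    · exact hpos A h hA
  refine ⟨hpos, isProbabilityMeasure_gpLoop hpos' _ _ _, ae_gpSampling_pos hr0 hpos',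
    map_gpSampling_eq_tropMeasure hr0 hpos' fun w => ?_⟩
  rw [tropDensity_toPosProj_exp ha hb hdeg, tropIntegrand_exp ha0 hb0 hν hρ hzA hzB
    (hzA.univ_eq hzB (hR2.trans intrinsicInterior_subset))]
  congr 3
  -- The value `r ∅ = 1` differs from `zA ∅ - zB ∅ = 0` and `r [n]` is arbitrary, but both sets have
  -- gap zero.
  exact lovaszSum_congr (fun T _ h1 h2 => (hr T h1 h2).symm) w
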